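/- Let $d$ be a natural number. An oriented complex $Q$ is a finite simplicial complex together with an orientation (a class of orderings of the vertices modulo even permutations) of each of its simplices, with no compatibility required; $Q_i$ denotes its set of $i$-simplices. It has degree bound $d$ if every vertex lies in at most $d$ edges. For a vertex $p$, let $B_r(p)$ be the oriented complex formed by all simplices whose vertices are at distance at most $r$ from $p$ in the $1$-skeleton, rooted at $p$. A sequence $(Q^n)_{n\ge1}$ of oriented complexes of degree bound $d$ is convergent if $|Q^n_0|\to\infty$ and, for every $r\ge 1$ and every rooted oriented $r$-ball $\beta$ of degree bound $d$, the proportion of vertices $p$ of $Q^n$ such that $B_r(p)\cong\beta$ (by an isomorphism preserving root and orientations) converges as $n\to\infty$. Let $C^i(Q)$ be the Euclidean space of real functions on $Q_i$, let $d_i:C^i(Q)\to C^{i+1}(Q)$ be the simplicial coboundary, $(d_if)(a_0,\dots,a_{i+1})=\sum_j(-1)^jf(a_0,\dots,\widehat{a_j},\dots,a_{i+1})$, and let $\Delta^i_Q=d_{i-1}d_{i-1}^*+d_i^*d_i$ (with $d_{-1}=0$). The normalized spectral measure $\mu^i_n$ of $\Delta^i_{Q^n}$ gives each eigenvalue $\lambda$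 the mass $(\text{multiplicity of }\lambda)/|Q^n_i|$ (it is the zero measure if $Q^n_i=\emptyset$). Proposition. Let $(Q^n)$ be a convergent sequence of oriented complexes of degree bound $d$. Then there is $K>0$ such that: 1. $\|\Delta^i_{Q^n}\|\le K$ for all $i\ge 0$ and all $n$; hence every $\mu^i_n$ is concentrated on $[0,K]$. 2. For every $i\ge 0$ such that $|Q^n_i|/|Q^n_0|$ does not tend to $0$, the measures $\mu^i_n$ converge weakly on $[0,K]$ as $n\to\infty$: there is a probability measure $\mu$ on $[0,K]$ with $\int_0^K f\,d\mu^i_n\to\int_0^K f\,d\mu$ for every continuous function $f$ on $[0,K]$. 3. For all $i\ge 0$ and all $n$, $\log$ is $\mu^i_n$-integrable on $(0,K]$ and $$c(\mu^i_n)=\lim_{\varepsilon\to0^+}\int_{[\varepsilon,K]}\log\lambda\,d\mu^i_n(\lambda)=\int_{(0,K]}\log\lambda\,d\mu^i_n(\lambda)\ \ge\ 0 .$$ -/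

import Mathlib

open Filter Topology MeasureTheory Set

/-- A simplicial complex with vertex set `V` together with an orientation of each of its simplices.
An orientation of a `k`-simplex is a class of orderings `(a₀, …, a_k)` of its vertices modulo even
permutations; `IsPos k a` says that `a` belongs to the chosen class of the simplex with vertices
`a₀, …, a_k`. The orientations of different simplices are unrelated, and a vertex has exactly one
orientation. -/
structure OrientedComplex (V : Type*) extends AbstractSimplicialComplex V where
  /-- `(a₀, …, a_k)` is a positive ordering of the vertices of a simplex. -/
  IsPos : (k : ℕ) → (Fin (k + 1) → V) → Prop
  isPos_injective : ∀ k a, IsPos k a → Function.Injective a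
  isPos_range : ∀ k a, IsPos k a → ∃ σ ∈ faces, (σ : Set V) = range a
  exists_isPos : ∀ k, ∀ σ ∈ faces, σ.card = k + 1 → ∃ a, IsPos k a ∧ (σ : Set V) = range a
  isPos_perm : ∀ k a, IsPos k a → ∀ π : Equiv.Perm (Fin (k + 1)),
    (IsPos k (a ∘ π) ↔ Equiv.Perm.sign π = 1)

namespace OrientedComplex

/-- The `k`-simplices of `Q`: the faces with `k + 1` vertices. -/
def Simplex {V : Type*} (Q : OrientedComplex V) (k : ℕ) : Type _ :=
  {σ : Finset V // σ ∈ Q.faces ∧ σ.card = k + 1}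

instance {V : Type*} [Finite V] (Q : OrientedComplex V) (k : ℕ) : Finite (Q.Simplex k) :=
  inferInstanceAs (Finite {σ : Finset V // σ ∈ Q.faces ∧ σ.card = k + 1})

noncomputable instance {V : Type*} [Finite V] (Q : OrientedComplex V) (k : ℕ) :
    Fintype (Q.Simplex k) :=
  Fintype.ofFinite _

/-- Every vertex lies in at most `d` edges. -/
def DegreeAtMost {V : Type*} (Q : OrientedComplex V) (d : ℕ) : Prop :=
  ∀ v : V, Nat.card {e : Q.Simplex 1 // v ∈ e.1} ≤ d

/-- The `1`-skeleton. -/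
def skeleton {V : Type*} (Q : OrientedComplex V) : SimpleGraph V where
  Adj v w := v ≠ w ∧ ∃ e : Q.Simplex 1, v ∈ e.1 ∧ w ∈ e.1
  symm := ⟨fun _ _ h => ⟨h.1.symm, h.2.imp fun _ he => ⟨he.2, he.1⟩⟩⟩
  loopless := ⟨fun _ h => h.1 rfl⟩

/-- The full oriented subcomplex spanned by a set `S` of vertices. -/
def restrict {V : Type*} (Q : OrientedComplex V) (S : Set V) : OrientedComplex S where
  faces := {σ | σ.map (Function.Embedding.subtype _) ∈ Q.faces}
  isRelLowerSet_faces := fun {σ} hσ => by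
    refine ⟨?_, fun τ hτσ hτ => ?_⟩
    · have := (Q.isRelLowerSet_faces hσ).1
      simpa using this
    · exact (Q.isRelLowerSet_faces hσ).2 (Finset.map_subset_map.2 hτσ) (by simpa using hτ)
  singleton_mem := fun v => by simpa using Q.singleton_mem v
  IsPos := fun k a => Q.IsPos k (fun j => (a j : V))
  isPos_injective := fun k a h => (Q.isPos_injective k _ h).of_comp
  isPos_range := fun k a h => by
    obtain ⟨σ, hσ, e⟩ := Q.isPos_range k _ h
    have hS : ∀ v ∈ σ, v ∈ S := fun v hv => by
      have : v ∈ (σ : Set V) := hv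
      rw [e] at this
      obtain ⟨j, rfl⟩ := this
      exact (a j).2
    classical
    have hmap : (σ.subtype (· ∈ S)).map (Function.Embedding.subtype _) = σ :=
      Finset.subtype_map_of_mem hS
    refine ⟨σ.subtype (· ∈ S), ?_, ?_⟩
    · change Finset.map _ _ ∈ Q.faces
      rw [hmap]
      exact hσ
    · ext v
      have : (v : V) ∈ (σ : Set V) ↔ (v : V) ∈ range (fun j => (a j : V)) := by rw [e]
      simpa [Subtype.ext_iff] using this
  exists_isPos := fun k σ hσ hc => by
    obtain ⟨a, ha, e⟩ := Q.exists_isPos k _ hσ (by simpa using hc)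
    have hmem : ∀ j, ∃ h : a j ∈ S, (⟨a j, h⟩ : S) ∈ σ := fun j => by
      have : a j ∈ range a := ⟨j, rfl⟩
      rw [← e] at this
      simpa using this
    refine ⟨fun j => ⟨a j, (hmem j).1⟩, ha, ?_⟩
    ext v
    have : (v : V) ∈ ((σ.map (Function.Embedding.subtype _) : Finset V) : Set V) ↔
        (v : V) ∈ range a := by rw [e]
    simpa [Subtype.ext_iff] using this
  isPos_perm := fun k a h π => Q.isPos_perm k _ h π

/-- The vertices at distance at most `r` from `p` in the `1`-skeleton. -/
def ballVertices {V : Type*} (Q : OrientedComplex V) (r : ℕ) (p : V) : Set V :=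
  {v | Q.skeleton.edist p v ≤ r}

theorem mem_ballVertices {V : Type*} (Q : OrientedComplex V) (r : ℕ) (p : V) :
    p ∈ Q.ballVertices r p := by
  simp [ballVertices]

/-- The ball `B_r(p)`: all simplices whose vertices are at distance at most `r` from `p`. -/
def ball {V : Type*} (Q : OrientedComplex V) (r : ℕ) (p : V) :
    OrientedComplex (Q.ballVertices r p) :=
  Q.restrict (Q.ballVertices r p)

/-- `(Q, x)` is a rooted oriented `r`-ball of vertex degree bound `d`. -/
def IsRootedBall {V : Type*} (d r : ℕ) (Q : OrientedComplex V) (x : V) : Prop :=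
  Q.DegreeAtMost d ∧ ∀ y, Q.skeleton.edist x y ≤ r

/-- Isomorphism of rooted oriented complexes: a bijection of the vertices that preserves the root,
the simplices and the orientations. -/
def RootedIso {V W : Type*} (Q : OrientedComplex V) (x : V) (L : OrientedComplex W) (y : W) :
    Prop :=
  ∃ e : V ≃ W, e x = y ∧ (∀ σ : Finset V, σ.map e.toEmbedding ∈ L.faces ↔ σ ∈ Q.faces) ∧
    ∀ k (a : Fin (k + 1) → V), L.IsPos k (e ∘ a) ↔ Q.IsPos k a

/-- The proportion of the vertices `p` of `Q` whose ball `B_r(p)` is isomorphic to `(L, x)`. -/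
noncomputable def ballFrequency {V W : Type*} (Q : OrientedComplex V) (r : ℕ)
    (L : OrientedComplex W) (x : W) : ℝ :=
  (Nat.card {p : V // RootedIso (Q.ball r p) ⟨p, Q.mem_ballVertices r p⟩ L x} : ℝ) / Nat.card V

/-- Convergence of a sequence of finite oriented complexes of vertex degree bound `d`: the number
of vertices tends to infinity and the frequency of each rooted oriented `r`-ball converges, for each
`r ≥ 1`. (Every finite ball is isomorphic to one with vertex set `Fin m`.) -/
def Convergent {V : ℕ → Type*} (d : ℕ) (Q : ∀ n, OrientedComplex (V n)) : Prop :=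
  Tendsto (fun n => Nat.card (V n)) atTop atTop ∧
    ∀ r ≥ 1, ∀ (m : ℕ) (L : OrientedComplex (Fin m)) (x : Fin m), IsRootedBall d r L x →
      ∃ p : ℝ, Tendsto (fun n => (Q n).ballFrequency r L x) atTop (𝓝 p)

/-- The ratio of the number of `i`-simplices to the number of vertices. -/
noncomputable def simplexDensity {V : Type*} (Q : OrientedComplex V) (i : ℕ) : ℝ :=
  (Nat.card (Q.Simplex i) : ℝ) / Nat.card V

/-- `C^k(Q)`: the Euclidean space of real functions on the `k`-simplices. -/
abbrev Cochain {V : Type*} [Finite V] (Q : OrientedComplex V) (k : ℕ) : Type _ :=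
  EuclideanSpace ℝ (Q.Simplex k)

open Classical in
/-- The value `f(a₀, …, a_k)` of a cochain on an ordered simplex: `f(σ)` if the ordering is a
positive ordering of the simplex `σ`, and `-f(σ)` if it is a negative one. -/
noncomputable def evalOrdered {V : Type*} [Finite V] (Q : OrientedComplex V) {k : ℕ}
    (f : Q.Cochain k) (a : Fin (k + 1) → V) : ℝ :=
  if h : ∃ σ : Q.Simplex k, (σ.1 : Set V) = range a then
    if Q.IsPos k a then f h.choose else -f h.choose
  else 0

/-- A positive ordering of a simplex. -/
noncomputable def posOrdering {V : Type*} (Q : OrientedComplex V) {k : ℕ} (τ : Q.Simplex k) :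
    Fin (k + 1) → V :=
  (Q.exists_isPos k τ.1 τ.2.1 τ.2.2).choose

/-- The coboundary `d_k : C^k(Q) → C^{k+1}(Q)`,
`(df)(a₀, …, a_{k+1}) = ∑ⱼ (-1)^j f(a₀, …, âⱼ, …, a_{k+1})`,
where `(a₀, …, a_{k+1})` is a positive ordering of the simplex. -/
noncomputable def coboundary {V : Type*} [Finite V] (Q : OrientedComplex V) (k : ℕ) :
    Q.Cochain k →L[ℝ] Q.Cochain (k + 1) :=
  LinearMap.toContinuousLinearMap
    { toFun := fun f => WithLp.toLp 2 fun τ =>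
        ∑ j : Fin (k + 2), (-1) ^ (j : ℕ) * Q.evalOrdered f (Q.posOrdering τ ∘ j.succAbove)
      map_add' := fun f g => by
        ext τ
        simp only [PiLp.add_apply, ← Finset.sum_add_distrib]
        refine Finset.sum_congr rfl fun j _ => ?_
        unfold evalOrdered
        split_ifs <;> simp <;> ring
      map_smul' := fun c f => by
        ext τ
        simp only [PiLp.smul_apply, smul_eq_mul, RingHom.id_apply, Finset.mul_sum]
        refine Finset.sum_congr rfl fun j _ => ?_
        unfold evalOrdered
        split_ifs <;> simp <;> ring }

theorem isPos_perm_iff {V : Type*} (Q : OrientedComplex V) {k : ℕ} (σ : Q.Simplex k)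
    (a : Fin (k + 1) → V) (ha : (σ.1 : Set V) = range a) (ρ : Equiv.Perm (Fin (k + 1))) :
    Q.IsPos k (a ∘ ρ) ↔ (Q.IsPos k a ↔ Equiv.Perm.sign ρ = 1) := by
  obtain ⟨b, hb, e⟩ := Q.exists_isPos k σ.1 σ.2.1 σ.2.2
  have hbi := Q.isPos_injective k b hb
  have hex : ∀ j, ∃ i, b i = a j := fun j => by
    have : a j ∈ range b := by rw [← e, ha]; exact ⟨j, rfl⟩
    exact this
  choose g hg using hex
  have hgs : Function.Surjective g := fun i => by
    have : b i ∈ range a := by rw [← ha, e]; exact ⟨i, rfl⟩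
    obtain ⟨j, hj⟩ := this
    exact ⟨j, hbi (by rw [hg, hj])⟩
  let γ := Equiv.ofBijective g (Finite.surjective_iff_bijective.1 hgs)
  have hγ : a = b ∘ γ := funext fun j => (hg j).symm
  have h1 := Q.isPos_perm k b hb γ
  have h2 := Q.isPos_perm k b hb (γ * ρ)
  rw [Equiv.Perm.coe_mul, ← Function.comp_assoc, ← hγ, Equiv.Perm.sign_mul] at h2
  rw [← hγ] at h1
  rw [h1, h2]
  rcases Int.units_eq_one_or (Equiv.Perm.sign γ) with h | h <;>
    rcases Int.units_eq_one_or (Equiv.Perm.sign ρ) with h' | h' <;> simp [h, h']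

/-- Cochains are alternating functions of ordered simplices. -/
theorem evalOrdered_perm {V : Type*} [Finite V] (Q : OrientedComplex V) {k : ℕ}
    (f : Q.Cochain k) (a : Fin (k + 1) → V) (ρ : Equiv.Perm (Fin (k + 1))) :
    Q.evalOrdered f (a ∘ ρ) = ((Equiv.Perm.sign ρ : ℤˣ) : ℤ) * Q.evalOrdered f a := by
  classical
  unfold evalOrdered
  have hr : range (a ∘ ρ) = range a := ρ.surjective.range_comp a
  simp only [hr]
  split_ifs with h h1 h2 h2
  all_goals try simp
  all_goals
    have h3 := Q.isPos_perm_iff h.choose a h.choose_spec ρ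
    rcases Int.units_eq_one_or (Equiv.Perm.sign ρ) with h' | h' <;> simp_all

/-- The coboundary formula holds for every ordering of the simplex, up to sign. -/
theorem alternating_sum_perm {V : Type*} [Finite V] (Q : OrientedComplex V) {k : ℕ}
    (f : Q.Cochain k) (b : Fin (k + 2) → V) (π : Equiv.Perm (Fin (k + 2))) :
    ∑ j : Fin (k + 2), (-1) ^ (j : ℕ) * Q.evalOrdered f ((b ∘ π) ∘ j.succAbove) =
      ((Equiv.Perm.sign π : ℤˣ) : ℤ) *
        ∑ j : Fin (k + 2), (-1) ^ (j : ℕ) * Q.evalOrdered f (b ∘ j.succAbove) := by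
  rw [← Equiv.sum_comp π (fun j => (-1 : ℝ) ^ (j : ℕ) * Q.evalOrdered f (b ∘ j.succAbove)),
    Finset.mul_sum]
  refine Finset.sum_congr rfl fun j _ => ?_
  let θ : Equiv.Perm (Fin (k + 2)) := (π j).cycleRange * π * (j.cycleRange)⁻¹
  have hθ0 : θ 0 = 0 := by
    simp [θ, Equiv.Perm.mul_apply, Equiv.Perm.inv_def]
  obtain ⟨⟨p, ρ⟩, hρ⟩ := Equiv.Perm.decomposeFin.symm.surjective θ
  have hp : p = 0 := by
    rw [← hθ0, ← hρ]; simp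
  subst hp
  have hsucc : ∀ i, π (j.succAbove i) = (π j).succAbove (ρ i) := fun i => by
    have h1 : θ i.succ = (ρ i).succ := by rw [← hρ]; simp
    have h2 : θ i.succ = (π j).cycleRange (π (j.succAbove i)) := by
      simp [θ, Equiv.Perm.mul_apply, Equiv.Perm.inv_def]
    rw [h2] at h1
    apply (π j).cycleRange.injective
    rw [h1, Fin.cycleRange_succAbove]
  have hs : Equiv.Perm.sign ρ = (-1) ^ ((π j : Fin (k + 2)) : ℕ) * Equiv.Perm.sign π *
      (-1) ^ (j : ℕ) := by
    have : Equiv.Perm.sign θ = Equiv.Perm.sign ρ := by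
      rw [← hρ, Equiv.Perm.decomposeFin.symm_sign]; simp
    rw [← this]
    simp [θ]
  have hc : (b ∘ π) ∘ j.succAbove = (b ∘ (π j).succAbove) ∘ ρ := by
    funext i; simp [hsucc]
  rw [hc, evalOrdered_perm, hs]
  push_cast
  have hj : ((-1 : ℝ) ^ (j : ℕ)) * (-1) ^ (j : ℕ) = 1 := by
    rw [← mul_pow]; simp
  linear_combination ((-1 : ℝ) ^ ((π j : Fin (k + 2)) : ℕ) *
    ((Equiv.Perm.sign π : ℤˣ) : ℤ) * Q.evalOrdered f (b ∘ (π j).succAbove)) * hj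

/-- The coboundary does not depend on the choice of the positive ordering. -/
theorem coboundary_apply {V : Type*} [Finite V] (Q : OrientedComplex V) {k : ℕ}
    (f : Q.Cochain k) (τ : Q.Simplex (k + 1)) (b : Fin (k + 2) → V) (hb : Q.IsPos (k + 1) b)
    (hτ : (τ.1 : Set V) = range b) :
    Q.coboundary k f τ =
      ∑ j : Fin (k + 2), (-1) ^ (j : ℕ) * Q.evalOrdered f (b ∘ j.succAbove) := by
  obtain ⟨ha, ha'⟩ := (Q.exists_isPos (k + 1) τ.1 τ.2.1 τ.2.2).choose_spec
  change ∑ j : Fin (k + 2), (-1) ^ (j : ℕ) * Q.evalOrdered f (Q.posOrdering τ ∘ j.succAbove) = _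
  change Q.IsPos (k + 1) (Q.posOrdering τ) at ha
  change (τ.1 : Set V) = range (Q.posOrdering τ) at ha'
  generalize Q.posOrdering τ = a at ha ha'
  have hex : ∀ j, ∃ i, b i = a j := fun j => by
    have : a j ∈ range b := by rw [← hτ, ha']; exact ⟨j, rfl⟩
    exact this
  choose g hg using hex
  have hgi : Function.Injective g := fun i j h =>
    Q.isPos_injective _ a ha (by rw [← hg i, ← hg j, h])
  let γ := Equiv.ofBijective g (Finite.injective_iff_bijective.1 hgi)
  have hγ : a = b ∘ γ := funext fun j => (hg j).symm
  have hs : Equiv.Perm.sign γ = 1 := (Q.isPos_perm _ b hb γ).1 (hγ ▸ ha)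
  rw [hγ, alternating_sum_perm, hs]
  simp

/-- The combinatorial Laplacian `Δ^i = d_{i-1} d_{i-1}^* + d_i^* d_i` on `C^i(Q)`, with
`d_{-1} = 0`. -/
noncomputable def laplacian {V : Type*} [Finite V] (Q : OrientedComplex V) :
    (i : ℕ) → (Q.Cochain i →L[ℝ] Q.Cochain i)
  | 0 => (ContinuousLinearMap.adjoint (Q.coboundary 0)).comp (Q.coboundary 0)
  | i + 1 => (Q.coboundary i).comp (ContinuousLinearMap.adjoint (Q.coboundary i)) +
      (ContinuousLinearMap.adjoint (Q.coboundary (i + 1))).comp (Q.coboundary (i + 1))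

end OrientedComplex

/-- The normalized spectral measure of an operator `P` on a finite-dimensional Euclidean space: the
measure on `ℝ` with an atom of mass (multiplicity of `l`) / (dimension) at each eigenvalue `l`. -/
noncomputable def spectralMeasure {E : Type*} [NormedAddCommGroup E] [InnerProductSpace ℝ E]
    [FiniteDimensional ℝ E] (P : E →L[ℝ] E) : Measure ℝ :=
  ∑ l ∈ (Module.End.finite_hasEigenvalue (P : E →ₗ[ℝ] E)).toFinset,
    ENNReal.ofReal
      ((Module.finrank ℝ (Module.End.eigenspace (P : E →ₗ[ℝ] E) l) : ℝ) / Module.finrank ℝ E) •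
      Measure.dirac l

/-- Weak convergence of measures on `[0, K]`, tested against `C[0, K]`. -/
def WeaklyConvergesOn (K : ℝ) (μs : ℕ → Measure ℝ) (μ : Measure ℝ) : Prop :=
  ∀ f : ℝ → ℝ, ContinuousOn f (Icc 0 K) →
    Tendsto (fun n => ∫ t in Icc 0 K, f t ∂(μs n)) atTop (𝓝 (∫ t in Icc 0 K, f t ∂μ))

/-- `c(μ) = ∫_{(0, K]} log t dμ(t)`. -/
noncomputable def logIntegral (K : ℝ) (μ : Measure ℝ) : ℝ :=
  ∫ t in Ioc 0 K, Real.log t ∂μ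

/-! In the standard bases the coboundary is a signed incidence matrix. Its entries are integers, and
the degree bound limits the number of nonzero entries in each row and column. The Schur test then
bounds the norm of the Laplacian uniformly in the dimension and in the complex
(`norm_laplacian_le`).

Weak convergence is proved by moments. The `k`-th moment of the spectral measure is the trace of the
`k`-th power of the Laplacian divided by the number of `i`-simplices. The Laplacian only relates
simplices one edge apart, so the diagonal entries of its `k`-th power at the simplices containing
`p` depend only on the oriented ball of radius `k + 1` around `p` (`localTrace_eq`). Such balls have
finitely many types (`exists_finite_ball_types`), hence the trace per vertex is a fixed finite
combination of ball frequencies and converges (`Convergent.exists_tendsto_trace`). For `k = 0` this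
is convergence of the number of `i`-simplices per vertex; when that limit is nonzero, division gives
convergence of the moments. Compactness of the space of probability measures on `[0, K]` and
Weierstrass approximation turn this into weak convergence (`exists_weaklyConvergesOn`).

For the logarithm, the characteristic polynomial has integer coefficients. Its lowest nonzero
coefficient is, up to sign, the product of the nonzero eigenvalues, which is therefore at least `1`
(`logIntegral_spectralMeasure_nonneg`). -/

/-! ### Spectral measures of symmetric operators -/

/-- The spectral measure as a sum over the eigenvalues listed with multiplicity. -/
theorem spectralMeasure_eq_sum {E : Type*} [NormedAddCommGroup E] [InnerProductSpace ℝ E]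
    [FiniteDimensional ℝ E] {P : E →L[ℝ] E} (hP : (P : E →ₗ[ℝ] E).IsSymmetric) {n : ℕ}
    (hn : Module.finrank ℝ E = n) :
    spectralMeasure P =
      ∑ i : Fin n, ENNReal.ofReal (n : ℝ)⁻¹ • Measure.dirac (hP.eigenvalues hn i) := by
  classical
  -- Group the indices by eigenvalue: for a symmetric operator each fibre has as many elements as
  -- the dimension of the eigenspace.
  rw [← Finset.sum_fiberwise_of_maps_to (s := Finset.univ)
    (t := (Module.End.finite_hasEigenvalue (P : E →ₗ[ℝ] E)).toFinset)
    (g := fun i => hP.eigenvalues hn i)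
    (fun i _ => by simpa using hP.hasEigenvalue_eigenvalues hn i)]
  refine Finset.sum_congr rfl fun l _ => ?_
  rw [Finset.sum_congr rfl (g := fun _ => ENNReal.ofReal (n : ℝ)⁻¹ • Measure.dirac l)
    (fun i hi => by rw [(Finset.mem_filter.1 hi).2])]
  have hc := hP.card_filter_eigenvalues_eq hn l
  simp only [RCLike.ofReal_real_eq_id, id_eq] at hc
  rw [Finset.sum_const, hc, ← smul_assoc, hn]
  congr 1
  rw [nsmul_eq_mul, ← ENNReal.ofReal_natCast, ← ENNReal.ofReal_mul (by positivity), div_eq_mul_inv]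

/-! ### Integration against finitely many equal point masses. -/

section SumDirac

variable {ι : Type*} [Fintype ι] (c : ℝ) (x : ι → ℝ)

/-- Points of `ℝ` are measurable, so no measurability of `f` is needed. In particular the
singularity of `log` at `0` is harmless. -/
theorem integrable_sum_dirac (f : ℝ → ℝ) :
    Integrable f (∑ i, ENNReal.ofReal c • Measure.dirac (x i)) :=
  integrable_finsetSum_measure.2 fun _ _ =>
    (integrable_dirac (by simp)).smul_measure ENNReal.ofReal_ne_top

theorem integral_sum_dirac (hc : 0 ≤ c) (f : ℝ → ℝ) :
    ∫ t, f t ∂(∑ i, ENNReal.ofReal c • Measure.dirac (x i)) = c * ∑ i, f (x i) := by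
  rw [integral_finsetSum_measure fun _ _ =>
    (integrable_dirac (by simp)).smul_measure ENNReal.ofReal_ne_top, Finset.mul_sum]
  refine Finset.sum_congr rfl fun i _ => ?_
  rw [integral_smul_measure, integral_dirac, ENNReal.toReal_ofReal hc, smul_eq_mul]

theorem setIntegral_sum_dirac (hc : 0 ≤ c) (f : ℝ → ℝ) {s : Set ℝ} (hs : MeasurableSet s) :
    ∫ t in s, f t ∂(∑ i, ENNReal.ofReal c • Measure.dirac (x i)) =
      c * ∑ i, s.indicator f (x i) := by
  rw [← integral_indicator hs, integral_sum_dirac c x hc]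

/-- With finitely many atoms, the contribution of each is constant once `ε` is below it (if it is
positive) and zero otherwise. -/
theorem tendsto_setIntegral_log_sum_dirac (hc : 0 ≤ c) (K : ℝ) :
    Tendsto (fun ε : ℝ => ∫ t in Icc ε K, Real.log t
        ∂(∑ i, ENNReal.ofReal c • Measure.dirac (x i))) (𝓝[>] 0)
      (𝓝 (logIntegral K (∑ i, ENNReal.ofReal c • Measure.dirac (x i)))) := by
  simp only [logIntegral, setIntegral_sum_dirac c x hc _ measurableSet_Icc,
    setIntegral_sum_dirac c x hc _ measurableSet_Ioc]
  refine (tendsto_finsetSum _ fun i _ => ?_).const_mul c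
  refine tendsto_const_nhds.congr' ?_
  by_cases h : 0 < x i
  · filter_upwards [Ioo_mem_nhdsGT h] with ε hε
    simp [indicator, h, hε.2.le]
  · filter_upwards [self_mem_nhdsWithin] with ε hε
    have : ¬ ε ≤ x i := fun h' => h (lt_of_lt_of_le hε h')
    simp [indicator, h, this]

end SumDirac

open Polynomial in
/-- The product of the nonzero roots of a monic integral polynomial that splits over `ℝ` is a
nonzero integer. -/
theorem one_le_abs_prod_roots_ne_zero {ι : Type*} [Fintype ι] (x : ι → ℝ) (p : ℤ[X])
    (hp : p.map (Int.castRingHom ℝ) = ∏ i, (X - C (x i))) :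
    1 ≤ |∏ i with x i ≠ 0, x i| := by
  classical
  -- If `m` roots vanish, `p` is `X ^ m` times the product over the nonzero roots, so its
  -- coefficient of degree `m` is the product of the negated nonzero roots.
  have h0 : ∏ i with x i = 0, (X - C (x i)) = X ^ (Finset.univ.filter fun i => x i = 0).card := by
    rw [Finset.prod_congr rfl (g := fun _ => X) (fun i hi => by simp [(Finset.mem_filter.1 hi).2]),
      Finset.prod_const]
  rw [← Finset.prod_filter_mul_prod_filter_not _ (fun i => x i = 0), h0] at hp
  have h1 := congrArg (fun q => q.coeff (Finset.univ.filter fun i => x i = 0).card) hp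
  simp only [coeff_map, coeff_X_pow_mul', le_refl, if_true, Nat.sub_self, coeff_zero_eq_eval_zero,
    eval_prod, eval_sub, eval_X, eval_C, zero_sub, Int.coe_castRingHom] at h1
  have h2 : |∏ i with x i ≠ 0, x i| = |∏ i with ¬ x i = 0, -x i| := by
    simp only [Finset.abs_prod, abs_neg, ne_eq]
  rw [h2, ← h1, ← Int.cast_abs]
  have h3 : p.coeff (Finset.univ.filter fun i => x i = 0).card ≠ 0 := fun h => by
    rw [h] at h1
    rw [Int.cast_zero] at h1
    refine (Finset.prod_ne_zero_iff.2 fun i hi => ?_) h1.symm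
    simpa using hi
  exact_mod_cast Int.one_le_abs h3

theorem LinearMap.IsSymmetric.trace_pow {E : Type*} [NormedAddCommGroup E] [InnerProductSpace ℝ E]
    [FiniteDimensional ℝ E] {T : E →ₗ[ℝ] E} (hT : T.IsSymmetric) {n : ℕ}
    (hn : Module.finrank ℝ E = n) (k : ℕ) :
    LinearMap.trace ℝ E (T ^ k) = ∑ i, hT.eigenvalues hn i ^ k := by
  rw [LinearMap.trace_eq_matrix_trace ℝ (hT.eigenvectorBasis hn).toBasis, ← LinearMap.toMatrix_pow,
    hT.toMatrix_eigenvectorBasis hn, Matrix.diagonal_pow, Matrix.trace_diagonal]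
  simp

theorem LinearMap.IsSymmetric.eigenvalues_mem_Icc {E : Type*} [NormedAddCommGroup E]
    [InnerProductSpace ℝ E] [FiniteDimensional ℝ E] {P : E →L[ℝ] E}
    (hP : (P : E →ₗ[ℝ] E).IsSymmetric) (hpos : ∀ x, 0 ≤ inner ℝ x (P x)) {K : ℝ} (hK : ‖P‖ ≤ K)
    {n : ℕ} (hn : Module.finrank ℝ E = n) (i : Fin n) : hP.eigenvalues hn i ∈ Icc 0 K := by
  refine ⟨eigenvalue_nonneg_of_nonneg (hP.hasEigenvalue_eigenvalues hn i) fun x => hpos x, ?_⟩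
  have h := hP.apply_eigenvectorBasis hn i
  have h1 := P.le_opNorm (hP.eigenvectorBasis hn i)
  rw [ContinuousLinearMap.coe_coe] at h
  rw [h, norm_smul] at h1
  simp only [OrthonormalBasis.norm_eq_one, mul_one] at h1
  exact (Real.le_norm_self _).trans (h1.trans hK)

/-- The spectral measure of a positive operator of norm at most `K` is concentrated on `[0, K]`. -/
theorem spectralMeasure_compl_Icc {E : Type*} [NormedAddCommGroup E]
    [InnerProductSpace ℝ E] [FiniteDimensional ℝ E] {P : E →L[ℝ] E}
    (hP : (P : E →ₗ[ℝ] E).IsSymmetric) (hpos : ∀ x, 0 ≤ inner ℝ x (P x)) {K : ℝ} (hK : ‖P‖ ≤ K) :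
    spectralMeasure P (Icc 0 K)ᶜ = 0 := by
  rw [spectralMeasure_eq_sum hP rfl, Measure.finsetSum_apply]
  refine Finset.sum_eq_zero fun i _ => ?_
  rw [Measure.smul_apply, Measure.dirac_apply' _ measurableSet_Icc.compl]
  simp [hP.eigenvalues_mem_Icc hpos hK rfl i]

/-- The bridge from measures to combinatorics: moments become normalized traces of matrix powers. -/
theorem setIntegral_pow_spectralMeasure {E : Type*} [NormedAddCommGroup E]
    [InnerProductSpace ℝ E] [FiniteDimensional ℝ E] {P : E →L[ℝ] E}
    (hP : (P : E →ₗ[ℝ] E).IsSymmetric) (hpos : ∀ x, 0 ≤ inner ℝ x (P x)) {K : ℝ} (hK : ‖P‖ ≤ K)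
    (k : ℕ) :
    ∫ t in Icc 0 K, t ^ k ∂(spectralMeasure P) =
      LinearMap.trace ℝ E ((P : E →ₗ[ℝ] E) ^ k) / Module.finrank ℝ E := by
  rw [spectralMeasure_eq_sum hP rfl, setIntegral_sum_dirac _ _ (by positivity) _ measurableSet_Icc,
    hP.trace_pow rfl, div_eq_inv_mul]
  congr 1
  refine Finset.sum_congr rfl fun i _ => ?_
  rw [indicator_of_mem (hP.eigenvalues_mem_Icc hpos hK rfl i)]

theorem isProbabilityMeasure_spectralMeasure {E : Type*} [NormedAddCommGroup E]
    [InnerProductSpace ℝ E] [FiniteDimensional ℝ E] {P : E →L[ℝ] E}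
    (hP : (P : E →ₗ[ℝ] E).IsSymmetric) (h : 0 < Module.finrank ℝ E) :
    IsProbabilityMeasure (spectralMeasure P) := by
  constructor
  rw [spectralMeasure_eq_sum hP rfl, Measure.finsetSum_apply]
  have : (0 : ℝ) < Module.finrank ℝ E := by exact_mod_cast h
  simp only [Measure.smul_apply, measure_univ, smul_eq_mul, mul_one, Finset.sum_const,
    Finset.card_univ, Fintype.card_fin, nsmul_eq_mul]
  rw [← ENNReal.ofReal_natCast, ← ENNReal.ofReal_mul (by positivity), mul_inv_cancel₀ this.ne',
    ENNReal.ofReal_one]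

open Polynomial in
theorem logIntegral_spectralMeasure_nonneg {E : Type*} [NormedAddCommGroup E]
    [InnerProductSpace ℝ E] [FiniteDimensional ℝ E] {P : E →L[ℝ] E}
    (hP : (P : E →ₗ[ℝ] E).IsSymmetric) (hpos : ∀ x, 0 ≤ inner ℝ x (P x)) {K : ℝ} (hK : ‖P‖ ≤ K)
    (p : ℤ[X]) (hp : p.map (Int.castRingHom ℝ) = (P : E →ₗ[ℝ] E).charpoly) :
    0 ≤ logIntegral K (spectralMeasure P) := by
  have hmem := hP.eigenvalues_mem_Icc hpos hK rfl
  rw [hP.charpoly_eq rfl] at hp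
  have h1 := one_le_abs_prod_roots_ne_zero _ p hp
  rw [spectralMeasure_eq_sum hP rfl, logIntegral,
    setIntegral_sum_dirac _ _ (by positivity) _ measurableSet_Ioc]
  refine mul_nonneg (by positivity) ?_
  -- The eigenvalues lie in `[0, K]`, so restricting to `(0, K]` only discards the zero ones.
  have h2 : ∀ i, (Ioc 0 K).indicator Real.log (hP.eigenvalues rfl i) =
      if hP.eigenvalues rfl i ≠ 0 then Real.log (hP.eigenvalues rfl i) else 0 := fun i => by
    by_cases h : hP.eigenvalues rfl i = 0
    · simp [h]
    · have : hP.eigenvalues rfl i ∈ Ioc 0 K := ⟨(hmem i).1.lt_of_ne' h, (hmem i).2⟩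
      simp [h, this]
  rw [Finset.sum_congr rfl fun i _ => h2 i, ← Finset.sum_filter, ← Real.log_prod, ← Real.log_abs]
  · exact Real.log_nonneg h1
  · intro i hi
    exact (Finset.mem_filter.1 hi).2

/-! ### The method of moments on a compact interval -/

theorem integral_eq_setIntegral_of_compl {μ : Measure ℝ} {s : Set ℝ}
    (h : μ sᶜ = 0) (f : ℝ → ℝ) : ∫ t in s, f t ∂μ = ∫ t, f t ∂μ := by
  rw [Measure.restrict_eq_self_of_ae_mem (measure_eq_zero_iff_ae_notMem.1 h |>.mono (by simp))]

open Polynomial in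
theorem tendsto_setIntegral_eval {K : ℝ} {ν : ℕ → Measure ℝ} {μ : Measure ℝ}
    [∀ n, IsFiniteMeasure (ν n)] [IsFiniteMeasure μ]
    (h : ∀ k : ℕ, Tendsto (fun n => ∫ t in Icc 0 K, t ^ k ∂(ν n)) atTop
      (𝓝 (∫ t in Icc 0 K, t ^ k ∂μ))) (p : ℝ[X]) :
    Tendsto (fun n => ∫ t in Icc 0 K, p.eval t ∂(ν n)) atTop
      (𝓝 (∫ t in Icc 0 K, p.eval t ∂μ)) := by
  have key : ∀ (ρ : Measure ℝ) [IsFiniteMeasure ρ], ∫ t in Icc 0 K, p.eval t ∂ρ =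
      ∑ k ∈ Finset.range (p.natDegree + 1), p.coeff k * ∫ t in Icc 0 K, t ^ k ∂ρ := by
    intro ρ _
    simp only [eval_eq_sum_range]
    rw [integral_finsetSum]
    · simp only [integral_const_mul]
    · intro k _
      have hk : IntegrableOn (fun t : ℝ => t ^ k) (Icc 0 K) ρ :=
        (continuous_pow k).continuousOn.integrableOn_compact isCompact_Icc
      exact hk.const_mul _
  simp only [key]
  exact tendsto_finsetSum _ fun k _ => (h k).const_mul _

/-- A polynomial uniformly within `ε / 3` of `f` on `[0, K]` changes every integral by at most `ε /
3`, because all total masses are `1`. -/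
theorem weaklyConvergesOn_of_tendsto_moments {K : ℝ} {ν : ℕ → Measure ℝ} {μ : Measure ℝ}
    [∀ n, IsProbabilityMeasure (ν n)] [IsProbabilityMeasure μ]
    (h : ∀ k : ℕ, Tendsto (fun n => ∫ t in Icc 0 K, t ^ k ∂(ν n)) atTop
      (𝓝 (∫ t in Icc 0 K, t ^ k ∂μ))) :
    WeaklyConvergesOn K ν μ := by
  intro f hf
  rw [Metric.tendsto_atTop]
  intro ε hε
  obtain ⟨p, hp⟩ := exists_polynomial_near_of_continuousOn 0 K f hf (ε / 3) (by positivity)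
  have key : ∀ (ρ : Measure ℝ) [IsProbabilityMeasure ρ],
      |∫ t in Icc 0 K, p.eval t ∂ρ - ∫ t in Icc 0 K, f t ∂ρ| ≤ ε / 3 := by
    intro ρ _
    rw [← integral_sub (p.continuous.continuousOn.integrableOn_compact isCompact_Icc)
      (hf.integrableOn_compact isCompact_Icc)]
    refine (norm_setIntegral_le_of_norm_le_const (f := fun t => p.eval t - f t) (C := ε / 3)
      (measure_lt_top _ _) fun x hx => (hp x hx).le).trans ?_
    exact mul_le_of_le_one_right (by positivity) measureReal_le_one
  obtain ⟨N, hN⟩ := Metric.tendsto_atTop.1 (tendsto_setIntegral_eval h p) (ε / 3) (by positivity)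
  refine ⟨N, fun n hn => ?_⟩
  have h1 := hN n hn
  have h2 := key (ν n)
  have h3 := key μ
  rw [Real.dist_eq] at h1 ⊢
  rw [abs_le] at h2 h3
  rw [abs_lt] at h1 ⊢
  constructor <;> linarith [h1.1, h1.2, h2.1, h2.2, h3.1, h3.2]

/-- If the moments of probability measures on `[0, K]` converge, then the measures converge
weakly. -/
theorem exists_weaklyConvergesOn {K : ℝ} {ν : ℕ → Measure ℝ}
    (hprob : ∀ᶠ n in atTop, IsProbabilityMeasure (ν n)) (hsupp : ∀ n, ν n (Icc 0 K)ᶜ = 0)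
    (hmom : ∀ k : ℕ, ∃ l, Tendsto (fun n => ∫ t in Icc 0 K, t ^ k ∂(ν n)) atTop (𝓝 l)) :
    ∃ μ : Measure ℝ, IsProbabilityMeasure μ ∧ μ (Icc 0 K)ᶜ = 0 ∧ WeaklyConvergesOn K ν μ := by
  -- The first few measures may be zero; shifting by `N` leaves only probability measures.
  obtain ⟨N, hN⟩ := eventually_atTop.1 hprob
  have hpr : ∀ n, IsProbabilityMeasure (ν (n + N)) := fun n => hN _ (by omega)
  choose l hl using hmom
  have hl' := fun k => (tendsto_add_atTop_iff_nat N).2 (hl k)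
  have hρ : ∀ n, IsProbabilityMeasure
      (Measure.comap (Subtype.val : Icc (0 : ℝ) K → ℝ) (ν (n + N))) := fun n => by
    constructor
    rw [comap_subtype_coe_apply measurableSet_Icc]
    rw [image_univ, Subtype.range_coe]
    exact (prob_compl_eq_zero_iff measurableSet_Icc).1 (hsupp (n + N))
  let ρ : ℕ → ProbabilityMeasure (Icc (0 : ℝ) K) := fun n => ⟨_, hρ n⟩
  -- On the compact space `Icc 0 K` the probability measures form a compact space, so they converge
  -- along an ultrafilter finer than `atTop`. This replaces a convergent subsequence.
  let U : Ultrafilter ℕ := Ultrafilter.of atTop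
  have hU : (U : Filter ℕ) ≤ atTop := Ultrafilter.of_le _
  obtain ⟨τ, hτ⟩ : ∃ τ, Tendsto ρ U (𝓝 τ) := by
    obtain ⟨τ, -, h⟩ := isCompact_univ.ultrafilter_le_nhds (U.map ρ) (by simp)
    exact ⟨τ, h⟩
  let μ : Measure ℝ := Measure.map Subtype.val (τ : Measure (Icc (0 : ℝ) K))
  have hμp : IsProbabilityMeasure μ :=
    Measure.isProbabilityMeasure_map measurable_subtype_coe.aemeasurable
  have hμs : μ (Icc 0 K)ᶜ = 0 := by
    rw [Measure.map_apply measurable_subtype_coe measurableSet_Icc.compl]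
    convert measure_empty (μ := (τ : Measure (Icc (0 : ℝ) K)))
    ext x
    simp
  refine ⟨μ, hμp, hμs, ?_⟩
  suffices h : WeaklyConvergesOn K (fun n => ν (n + N)) μ from fun f hf =>
    (tendsto_add_atTop_iff_nat N).1 (h f hf)
  refine weaklyConvergesOn_of_tendsto_moments fun k => ?_
  convert hl' k using 2
  -- The moments converge along the whole sequence, so the limit along `U` has these same limits as
  -- its moments.
  refine tendsto_nhds_unique (f := fun n => ∫ t in Icc 0 K, t ^ k ∂(ν (n + N))) (l := (U : Filter ℕ))
    ?_ ((hl' k).mono_left hU)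
  let g : BoundedContinuousFunction (Icc (0 : ℝ) K) ℝ :=
    BoundedContinuousFunction.mkOfCompact ⟨fun t => (t : ℝ) ^ k, by fun_prop⟩
  have h1 := ProbabilityMeasure.tendsto_iff_forall_integral_tendsto.1 hτ g
  have h2 : ∫ t in Icc 0 K, t ^ k ∂μ = ∫ t, g t ∂(τ : Measure (Icc (0 : ℝ) K)) := by
    rw [integral_eq_setIntegral_of_compl hμs, integral_map measurable_subtype_coe.aemeasurable
      (by fun_prop)]
    rfl
  rw [h2]
  refine h1.congr fun n => ?_
  exact integral_subtype_comap measurableSet_Icc (fun t : ℝ => t ^ k)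

namespace OrientedComplex

noncomputable instance {V : Type*} (Q : OrientedComplex V) (k : ℕ) : DecidableEq (Q.Simplex k) :=
  Classical.decEq _

/-! ### The matrix of the Laplacian -/

theorem isPos_posOrdering {V : Type*} (Q : OrientedComplex V) {k : ℕ} (τ : Q.Simplex k) :
    Q.IsPos k (Q.posOrdering τ) :=
  (Q.exists_isPos k τ.1 τ.2.1 τ.2.2).choose_spec.1

theorem coe_eq_range_posOrdering {V : Type*} (Q : OrientedComplex V) {k : ℕ} (τ : Q.Simplex k) :
    (τ.1 : Set V) = range (Q.posOrdering τ) :=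
  (Q.exists_isPos k τ.1 τ.2.1 τ.2.2).choose_spec.2

section Matrices

variable {V : Type*} [Finite V] (Q : OrientedComplex V)

open Classical in
theorem evalOrdered_single {k : ℕ} (σ : Q.Simplex k) (a : Fin (k + 1) → V) :
    Q.evalOrdered (EuclideanSpace.single σ 1) a =
      if (σ.1 : Set V) = range a then (if Q.IsPos k a then 1 else -1) else 0 := by
  unfold evalOrdered
  by_cases h : ∃ τ : Q.Simplex k, (τ.1 : Set V) = range a
  · have h1 : h.choose = σ ↔ (σ.1 : Set V) = range a := by
      refine ⟨fun h' => h' ▸ h.choose_spec, fun h' => Subtype.ext (Finset.coe_injective ?_)⟩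
      exact h.choose_spec.trans h'.symm
    rw [dif_pos h]
    by_cases h2 : (σ.1 : Set V) = range a
    · simp [h1.2 h2, h2]
    · have h3 : h.choose ≠ σ := fun h' => h2 (h1.1 h')
      simp [h3, h2]
  · rw [dif_neg h, if_neg fun h' => h ⟨σ, h'⟩]

/-- The incidence matrix: the matrix of the coboundary in the standard bases. -/
noncomputable def incidence (k : ℕ) : Matrix (Q.Simplex (k + 1)) (Q.Simplex k) ℝ :=
  fun τ σ => Q.coboundary k (EuclideanSpace.single σ 1) τ

open Classical in
-- The positive ordering `b` is arbitrary because embeddings preserve positive orderings but need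
-- not carry the chosen `posOrdering` to the chosen one.
theorem incidence_eq_sum {k : ℕ} (τ : Q.Simplex (k + 1)) (σ : Q.Simplex k)
    (b : Fin (k + 2) → V) (hb : Q.IsPos (k + 1) b) (hτ : (τ.1 : Set V) = range b) :
    Q.incidence k τ σ = ∑ j : Fin (k + 2), (-1) ^ (j : ℕ) *
      (if (σ.1 : Set V) = range (b ∘ j.succAbove) then
        (if Q.IsPos k (b ∘ j.succAbove) then 1 else -1) else 0) := by
  rw [incidence, Q.coboundary_apply _ τ b hb hτ]
  simp only [evalOrdered_single]

theorem exists_int_incidence {k : ℕ} (τ : Q.Simplex (k + 1)) (σ : Q.Simplex k) :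
    ∃ z : ℤ, Q.incidence k τ σ = z := by
  classical
  refine ⟨∑ j : Fin (k + 2), (-1) ^ (j : ℕ) *
      (if (σ.1 : Set V) = range (Q.posOrdering τ ∘ j.succAbove) then
        (if Q.IsPos k (Q.posOrdering τ ∘ j.succAbove) then 1 else -1) else 0), ?_⟩
  rw [Q.incidence_eq_sum τ σ _ (Q.isPos_posOrdering τ) (Q.coe_eq_range_posOrdering τ)]
  push_cast
  rfl

theorem abs_incidence_le {k : ℕ} (τ : Q.Simplex (k + 1)) (σ : Q.Simplex k) :
    |Q.incidence k τ σ| ≤ τ.1.card := by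
  classical
  rw [Q.incidence_eq_sum τ σ _ (Q.isPos_posOrdering τ) (Q.coe_eq_range_posOrdering τ), τ.2.2]
  refine (Finset.abs_sum_le_sum_abs _ _).trans
    ((Finset.sum_le_card_nsmul _ _ 1 fun j _ => ?_).trans ?_)
  · rw [abs_mul, abs_pow, abs_neg, abs_one, one_pow, one_mul]
    split_ifs <;> simp
  · simp
    norm_num [add_assoc]

theorem subset_of_incidence_ne_zero {k : ℕ} {τ : Q.Simplex (k + 1)} {σ : Q.Simplex k}
    (h : Q.incidence k τ σ ≠ 0) : σ.1 ⊆ τ.1 := by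
  classical
  rw [Q.incidence_eq_sum τ σ _ (Q.isPos_posOrdering τ) (Q.coe_eq_range_posOrdering τ)] at h
  obtain ⟨j, -, hj⟩ := Finset.exists_ne_zero_of_sum_ne_zero h
  have h1 : (σ.1 : Set V) = range (Q.posOrdering τ ∘ j.succAbove) := by
    by_contra h'
    simp [h'] at hj
  rw [← Finset.coe_subset, h1, Q.coe_eq_range_posOrdering τ]
  exact range_comp_subset_range _ _

theorem coboundary_apply_eq_sum {k : ℕ} (f : Q.Cochain k) (τ : Q.Simplex (k + 1)) :
    Q.coboundary k f τ = ∑ σ, Q.incidence k τ σ * f σ := by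
  have hf : f = ∑ σ, f σ • EuclideanSpace.single σ (1 : ℝ) := by
    ext σ
    simp [Pi.single_apply]
  conv_lhs => rw [hf]
  rw [map_sum]
  simp [incidence, mul_comm]

theorem adjoint_coboundary_apply {k : ℕ} (g : Q.Cochain (k + 1)) (σ : Q.Simplex k) :
    ContinuousLinearMap.adjoint (Q.coboundary k) g σ = ∑ τ, Q.incidence k τ σ * g τ := by
  have h := ContinuousLinearMap.adjoint_inner_right (Q.coboundary k) (EuclideanSpace.single σ 1) g
  rw [EuclideanSpace.inner_single_left] at h
  simp only [map_one, one_mul] at h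
  rw [h, PiLp.inner_apply]
  simp [incidence, mul_comm]

/-- The matrix of the Laplacian in the standard basis. -/
noncomputable def lapMatrix : (i : ℕ) → Matrix (Q.Simplex i) (Q.Simplex i) ℝ
  | 0 => (Q.incidence 0).transpose * Q.incidence 0
  | i + 1 => Q.incidence i * (Q.incidence i).transpose +
      (Q.incidence (i + 1)).transpose * Q.incidence (i + 1)

theorem adjoint_coboundary_coboundary_single {i : ℕ} (ρ σ : Q.Simplex i) :
    (ContinuousLinearMap.adjoint (Q.coboundary i)).comp (Q.coboundary i)
      (EuclideanSpace.single ρ 1) σ = ((Q.incidence i).transpose * Q.incidence i) σ ρ := by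
  simp only [ContinuousLinearMap.comp_apply, adjoint_coboundary_apply, Matrix.mul_apply,
    Matrix.transpose_apply]
  rfl

theorem coboundary_adjoint_coboundary_single {i : ℕ} (ρ σ : Q.Simplex (i + 1)) :
    (Q.coboundary i).comp (ContinuousLinearMap.adjoint (Q.coboundary i))
      (EuclideanSpace.single ρ 1) σ = (Q.incidence i * (Q.incidence i).transpose) σ ρ := by
  simp only [ContinuousLinearMap.comp_apply, coboundary_apply_eq_sum, adjoint_coboundary_apply,
    Matrix.mul_apply, Matrix.transpose_apply]
  simp [PiLp.single_apply]

theorem laplacian_single {i : ℕ} (ρ σ : Q.Simplex i) :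
    Q.laplacian i (EuclideanSpace.single ρ 1) σ = Q.lapMatrix i σ ρ := by
  cases i with
  | zero => exact Q.adjoint_coboundary_coboundary_single ρ σ
  | succ i =>
    simp only [laplacian, lapMatrix, _root_.add_apply, PiLp.add_apply,
      Matrix.add_apply, adjoint_coboundary_coboundary_single, coboundary_adjoint_coboundary_single]

theorem toMatrix_laplacian (i : ℕ) :
    LinearMap.toMatrix (EuclideanSpace.basisFun (Q.Simplex i) ℝ).toBasis
      (EuclideanSpace.basisFun (Q.Simplex i) ℝ).toBasis
      (Q.laplacian i : Q.Cochain i →ₗ[ℝ] Q.Cochain i) = Q.lapMatrix i := by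
  ext σ ρ
  rw [LinearMap.toMatrix_apply]
  simp [laplacian_single]

theorem trace_laplacian_pow (i k : ℕ) :
    LinearMap.trace ℝ _ ((Q.laplacian i : Q.Cochain i →ₗ[ℝ] Q.Cochain i) ^ k) =
      (Q.lapMatrix i ^ k).trace := by
  rw [LinearMap.trace_eq_matrix_trace ℝ (EuclideanSpace.basisFun (Q.Simplex i) ℝ).toBasis,
    ← LinearMap.toMatrix_pow, toMatrix_laplacian]

theorem exists_int_lapMatrix (i : ℕ) :
    ∃ Z : Matrix (Q.Simplex i) (Q.Simplex i) ℤ, Z.map (Int.castRingHom ℝ) = Q.lapMatrix i := by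
  have h : ∀ k, ∃ D : Matrix (Q.Simplex (k + 1)) (Q.Simplex k) ℤ,
      D.map (Int.castRingHom ℝ) = Q.incidence k := fun k => by
    choose D hD using fun τ σ => Q.exists_int_incidence (k := k) τ σ
    exact ⟨D, by ext τ σ; exact (hD τ σ).symm⟩
  choose D hD using h
  cases i with
  | zero => exact ⟨(D 0).transpose * D 0, by
      rw [Matrix.map_mul, Matrix.transpose_map, hD]; rfl⟩
  | succ i => exact ⟨D i * (D i).transpose + (D (i + 1)).transpose * D (i + 1), by
      rw [Matrix.map_add _ (by simp), Matrix.map_mul, Matrix.map_mul, Matrix.transpose_map,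
        Matrix.transpose_map, hD, hD]; rfl⟩

theorem exists_int_charpoly_laplacian (i : ℕ) :
    ∃ p : Polynomial ℤ, p.map (Int.castRingHom ℝ) =
      (Q.laplacian i : Q.Cochain i →ₗ[ℝ] Q.Cochain i).charpoly := by
  obtain ⟨Z, hZ⟩ := Q.exists_int_lapMatrix i
  refine ⟨Z.charpoly, ?_⟩
  rw [← Matrix.charpoly_map, hZ, ← toMatrix_laplacian, LinearMap.charpoly_toMatrix]

theorem isPositive_laplacian (i : ℕ) : (Q.laplacian i).IsPositive := by
  cases i with
  | zero => exact ContinuousLinearMap.isPositive_adjoint_comp_self _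
  | succ i =>
    exact (ContinuousLinearMap.isPositive_self_comp_adjoint (Q.coboundary i)).add
      (ContinuousLinearMap.isPositive_adjoint_comp_self (Q.coboundary (i + 1)))

end Matrices

/-! ### Neighbourhoods of vertices -/

/-- The vertex `v` and its neighbours. -/
def closedNbhd {V : Type*} (Q : OrientedComplex V) (v : V) : Set V :=
  {w | w = v ∨ Q.skeleton.Adj v w}

/-- Two distinct vertices of a simplex span a face of it, which is an edge. -/
theorem subset_closedNbhd {V : Type*} (Q : OrientedComplex V) {k : ℕ} (σ : Q.Simplex k) {v : V}
    (hv : v ∈ σ.1) : (σ.1 : Set V) ⊆ Q.closedNbhd v := by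
  classical
  intro w hw
  by_cases h : w = v
  · exact Or.inl h
  · refine Or.inr ⟨Ne.symm h, ⟨{v, w}, ?_, Finset.card_pair (Ne.symm h)⟩, by simp, by simp⟩
    refine (Q.isRelLowerSet_faces σ.2.1).2 ?_ (by simp)
    intro u hu
    rcases Finset.mem_insert.1 hu with rfl | hu
    · exact hv
    · rw [Finset.mem_singleton.1 hu]
      exact hw

theorem ncard_closedNbhd_le {V : Type*} [Finite V] (Q : OrientedComplex V) {d : ℕ}
    (hd : Q.DegreeAtMost d) (v : V) : (Q.closedNbhd v).ncard ≤ d + 1 := by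
  classical
  have h1 : Q.closedNbhd v = insert v {w | Q.skeleton.Adj v w} := rfl
  rw [h1]
  refine (ncard_insert_le _ _).trans (Nat.add_le_add_right (le_trans ?_ (hd v)) 1)
  rw [← Nat.card_coe_set_eq]
  choose e he using fun w : {w | Q.skeleton.Adj v w} => w.2.2
  refine Nat.card_le_card_of_injective (fun w => (⟨e w, (he w).1⟩ : {e : Q.Simplex 1 // v ∈ e.1}))
    fun w w' h => ?_
  have h2 : e w = e w' := congrArg Subtype.val h
  by_contra hne
  -- Distinct neighbours need distinct edges at `v`, since an edge cannot have three vertices.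
  have h3 : ({v, w.1, w'.1} : Finset V) ⊆ (e w).1 := by
    intro u hu
    simp only [Finset.mem_insert, Finset.mem_singleton] at hu
    rcases hu with rfl | rfl | rfl
    · exact (he w).1
    · exact (he w).2
    · rw [h2]; exact (he w').2
  have h4 := Finset.card_le_card h3
  rw [(e w).2.2, Finset.card_eq_three.2 ⟨v, w.1, w'.1, w.2.1, w'.2.1,
    fun h => hne (Subtype.ext h), rfl⟩] at h4
  omega

theorem card_simplex_subset_closedNbhd_le {V : Type*} [Finite V] (Q : OrientedComplex V) {d : ℕ}
    (hd : Q.DegreeAtMost d) (k : ℕ) (v : V) (s : Finset (Q.Simplex k))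
    (hs : ∀ σ ∈ s, (σ.1 : Set V) ⊆ Q.closedNbhd v) : s.card ≤ 2 ^ (d + 1) := by
  classical
  have hfin := Set.toFinite (Q.closedNbhd v)
  have h1 : s.card ≤ hfin.toFinset.powerset.card :=
    Finset.card_le_card_of_injOn Subtype.val (fun σ hσ => by
      simpa [← Finset.coe_subset] using hs σ hσ) Subtype.val_injective.injOn
  rw [Finset.card_powerset, ← ncard_eq_toFinset_card _ hfin] at h1
  exact h1.trans (Nat.pow_le_pow_right two_pos (Q.ncard_closedNbhd_le hd v))

/-- Bounds the dimension of simplices by `d`, which makes the norm estimates independent of the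
degree of the cochains. -/
theorem card_le_of_degreeAtMost {V : Type*} [Finite V] (Q : OrientedComplex V) {d : ℕ}
    (hd : Q.DegreeAtMost d) {k : ℕ} (σ : Q.Simplex k) : σ.1.card ≤ d + 1 := by
  obtain ⟨v, hv⟩ := (Q.isRelLowerSet_faces σ.2.1).1
  have := ncard_le_ncard (Q.subset_closedNbhd σ hv)
  rw [ncard_coe_finset] at this
  exact this.trans (Q.ncard_closedNbhd_le hd v)

/-! ### The norm of the Laplacian -/

/-- The Schur test. -/
theorem sum_sq_le_of_row_col_sums {m n : Type*} [Fintype m] [Fintype n] (A : Matrix m n ℝ) {S : ℝ}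
    (hS : 0 ≤ S) (hrow : ∀ i, ∑ j, |A i j| ≤ S) (hcol : ∀ j, ∑ i, |A i j| ≤ S) (x : n → ℝ) :
    ∑ i, (∑ j, A i j * x j) ^ 2 ≤ S ^ 2 * ∑ j, x j ^ 2 := by
  -- Cauchy–Schwarz, with `|A i j|` split as a weight between the two factors.
  have h1 : ∀ i, (∑ j, A i j * x j) ^ 2 ≤ S * ∑ j, |A i j| * x j ^ 2 := fun i => by
    refine le_trans ?_ (mul_le_mul_of_nonneg_right (hrow i)
      (Finset.sum_nonneg fun j _ => mul_nonneg (abs_nonneg _) (sq_nonneg _)))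
    refine Finset.sum_sq_le_sum_mul_sum_of_sq_le_mul _ (fun j _ => abs_nonneg _)
      (fun j _ => mul_nonneg (abs_nonneg _) (sq_nonneg _)) fun j _ => ?_
    rw [mul_pow, ← mul_assoc, ← sq, sq_abs]
  calc ∑ i, (∑ j, A i j * x j) ^ 2 ≤ ∑ i, S * ∑ j, |A i j| * x j ^ 2 :=
        Finset.sum_le_sum fun i _ => h1 i
    _ = S * ∑ j, (∑ i, |A i j|) * x j ^ 2 := by
        rw [← Finset.mul_sum, Finset.sum_comm]
        simp only [Finset.sum_mul]
    _ ≤ S * ∑ j, S * x j ^ 2 := by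
        gcongr with j
        exact hcol j
    _ = S ^ 2 * ∑ j, x j ^ 2 := by rw [← Finset.mul_sum]; ring

section Norm

variable {V : Type*} [Finite V] (Q : OrientedComplex V) {d : ℕ}

/-- Indexing by two maps from `ι` treats row sums (`τ` constant) and column sums (`σ` constant)
together. -/
theorem sum_abs_incidence_le (hd : Q.DegreeAtMost d) {ι : Type*} {k : ℕ} (s : Finset ι)
    (τ : ι → Q.Simplex (k + 1)) (σ : ι → Q.Simplex k) (hs : (s.filter fun i => Q.incidence k (τ i) (σ i) ≠ 0).card ≤
      2 ^ (d + 1)) :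
    ∑ i ∈ s, |Q.incidence k (τ i) (σ i)| ≤ 2 ^ (d + 1) * (d + 1) := by
  classical
  have h1 : ∑ i ∈ s.filter (fun i => Q.incidence k (τ i) (σ i) ≠ 0),
      |Q.incidence k (τ i) (σ i)| = ∑ i ∈ s, |Q.incidence k (τ i) (σ i)| :=
    Finset.sum_filter_of_ne fun i _ h => by simpa using h
  rw [← h1]
  refine (Finset.sum_le_card_nsmul _ _ ((d : ℝ) + 1) fun i _ => ?_).trans ?_
  · exact (Q.abs_incidence_le _ _).trans (by exact_mod_cast Q.card_le_of_degreeAtMost hd (τ i))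
  · rw [nsmul_eq_mul]
    gcongr
    exact_mod_cast hs

theorem norm_coboundary_le (hd : Q.DegreeAtMost d) (k : ℕ) :
    ‖Q.coboundary k‖ ≤ 2 ^ (d + 1) * (d + 1) := by
  classical
  have hS : (0 : ℝ) ≤ 2 ^ (d + 1) * (d + 1) := by positivity
  refine ContinuousLinearMap.opNorm_le_bound _ hS fun f => ?_
  rw [← abs_of_nonneg (norm_nonneg (Q.coboundary k f)), ← abs_of_nonneg (mul_nonneg hS
    (norm_nonneg f)), ← sq_le_sq, mul_pow, EuclideanSpace.norm_sq_eq, EuclideanSpace.norm_sq_eq]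
  simp only [Real.norm_eq_abs, sq_abs, coboundary_apply_eq_sum]
  refine sum_sq_le_of_row_col_sums (Q.incidence k) hS (fun τ => ?_) (fun σ => ?_) f
  · refine Q.sum_abs_incidence_le hd _ (fun _ => τ) id ?_
    obtain ⟨v, hv⟩ := (Q.isRelLowerSet_faces τ.2.1).1
    refine Q.card_simplex_subset_closedNbhd_le hd _ v _ fun σ hσ => ?_
    exact (Finset.coe_subset.2 (Q.subset_of_incidence_ne_zero (Finset.mem_filter.1 hσ).2)).trans
      (Q.subset_closedNbhd τ hv)
  · refine Q.sum_abs_incidence_le hd _ id (fun _ => σ) ?_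
    obtain ⟨v, hv⟩ := (Q.isRelLowerSet_faces σ.2.1).1
    refine Q.card_simplex_subset_closedNbhd_le hd _ v _ fun τ hτ => ?_
    exact Q.subset_closedNbhd τ (Q.subset_of_incidence_ne_zero (Finset.mem_filter.1 hτ).2 hv)

theorem norm_laplacian_le (hd : Q.DegreeAtMost d) (i : ℕ) :
    ‖Q.laplacian i‖ ≤ 2 * (2 ^ (d + 1) * (d + 1)) ^ 2 := by
  have h1 : ∀ k, ‖(ContinuousLinearMap.adjoint (Q.coboundary k)).comp (Q.coboundary k)‖ ≤
      (2 ^ (d + 1) * (d + 1)) ^ 2 := fun k => by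
    refine (ContinuousLinearMap.opNorm_comp_le _ _).trans ?_
    rw [LinearIsometryEquiv.norm_map, sq]
    gcongr <;> exact Q.norm_coboundary_le hd k
  have h2 : ∀ k, ‖(Q.coboundary k).comp (ContinuousLinearMap.adjoint (Q.coboundary k))‖ ≤
      (2 ^ (d + 1) * (d + 1)) ^ 2 := fun k => by
    refine (ContinuousLinearMap.opNorm_comp_le _ _).trans ?_
    rw [LinearIsometryEquiv.norm_map, sq]
    gcongr <;> exact Q.norm_coboundary_le hd k
  cases i with
  | zero =>
    refine (h1 0).trans ?_
    rw [two_mul]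
    exact le_add_of_nonneg_left (by positivity)
  | succ i =>
    refine (norm_add_le _ _).trans ?_
    rw [two_mul]
    exact add_le_add (h2 i) (h1 (i + 1))

end Norm

end OrientedComplex

namespace OrientedComplex

/-! ### Full embeddings -/

/-- `e` identifies `L` with the full oriented subcomplex of `Q` spanned by the range of `e`. -/
structure IsFullEmbedding {W V : Type*} (L : OrientedComplex W) (Q : OrientedComplex V)
    (e : W ↪ V) : Prop where
  map_mem_faces : ∀ σ : Finset W, σ.map e ∈ Q.faces ↔ σ ∈ L.faces
  isPos_comp : ∀ k (a : Fin (k + 1) → W), Q.IsPos k (e ∘ a) ↔ L.IsPos k a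

namespace IsFullEmbedding

variable {W V : Type*} {L : OrientedComplex W} {Q : OrientedComplex V} {e : W ↪ V}

/-- The map of simplices induced by a full embedding. -/
def simplexMap (h : L.IsFullEmbedding Q e) {k : ℕ} (σ : L.Simplex k) : Q.Simplex k :=
  ⟨σ.1.map e, (h.map_mem_faces σ.1).2 σ.2.1, by rw [Finset.card_map]; exact σ.2.2⟩

theorem coe_simplexMap (h : L.IsFullEmbedding Q e) {k : ℕ} (σ : L.Simplex k) :
    ((h.simplexMap σ).1 : Set V) = e '' σ.1 :=
  Finset.coe_map _ _

theorem mem_simplexMap (h : L.IsFullEmbedding Q e) {k : ℕ} (σ : L.Simplex k) (x : W) :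
    e x ∈ (h.simplexMap σ).1 ↔ x ∈ σ.1 :=
  Finset.mem_map' e

theorem simplexMap_injective (h : L.IsFullEmbedding Q e) {k : ℕ} :
    Function.Injective (h.simplexMap (k := k)) := fun _ _ hστ =>
  Subtype.ext (Finset.map_injective e (congrArg Subtype.val hστ))

theorem mem_range_simplexMap (h : L.IsFullEmbedding Q e) {k : ℕ} (σ : Q.Simplex k)
    (hσ : (σ.1 : Set V) ⊆ range e) : σ ∈ range (h.simplexMap (k := k)) := by
  classical
  have h1 : (σ.1.preimage e e.injective.injOn).map e = σ.1 := by
    rw [← Finset.coe_inj, Finset.coe_map, Finset.coe_preimage, image_preimage_eq_of_subset hσ]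
  refine ⟨⟨σ.1.preimage e e.injective.injOn, (h.map_mem_faces _).1 (by rw [h1]; exact σ.2.1), ?_⟩,
    Subtype.ext h1⟩
  rw [← Finset.card_map e, h1]
  exact σ.2.2

theorem adj_of_adj (h : L.IsFullEmbedding Q e) {x y : W} (hxy : Q.skeleton.Adj (e x) (e y)) :
    L.skeleton.Adj x y := by
  classical
  obtain ⟨hne, τ, hx, hy⟩ := hxy
  refine ⟨fun h' => hne (congrArg e h'), ?_⟩
  have h1 : ({e x, e y} : Finset V) = τ.1 := by
    refine Finset.eq_of_subset_of_card_le (fun u hu => ?_) ?_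
    · rcases Finset.mem_insert.1 hu with rfl | hu
      · exact hx
      · rwa [Finset.mem_singleton.1 hu]
    · rw [Finset.card_pair hne, τ.2.2]
  obtain ⟨ρ, hρ⟩ := h.mem_range_simplexMap τ (by
    rw [← h1]
    intro u hu
    simp only [Finset.coe_insert, Finset.coe_singleton, mem_insert_iff, mem_singleton_iff] at hu
    rcases hu with rfl | rfl <;> exact mem_range_self _)
  exact ⟨ρ, (h.mem_simplexMap ρ x).1 (hρ ▸ hx), (h.mem_simplexMap ρ y).1 (hρ ▸ hy)⟩

theorem incidence_simplexMap [Finite W] [Finite V] (h : L.IsFullEmbedding Q e) {k : ℕ}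
    (τ : L.Simplex (k + 1)) (σ : L.Simplex k) :
    Q.incidence k (h.simplexMap τ) (h.simplexMap σ) = L.incidence k τ σ := by
  classical
  rw [L.incidence_eq_sum τ σ _ (L.isPos_posOrdering τ) (L.coe_eq_range_posOrdering τ),
    Q.incidence_eq_sum (h.simplexMap τ) (h.simplexMap σ) (e ∘ L.posOrdering τ)
      ((h.isPos_comp _ _).2 (L.isPos_posOrdering τ))
      (by rw [coe_simplexMap, L.coe_eq_range_posOrdering τ, range_comp])]
  refine Finset.sum_congr rfl fun j _ => ?_
  have h1 : ((h.simplexMap σ).1 : Set V) = range ((e ∘ L.posOrdering τ) ∘ j.succAbove) ↔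
      (σ.1 : Set W) = range (L.posOrdering τ ∘ j.succAbove) := by
    rw [Function.comp_assoc, range_comp e, coe_simplexMap, e.injective.image_injective.eq_iff]
  have h2 := h.isPos_comp k (L.posOrdering τ ∘ j.succAbove)
  rw [← Function.comp_assoc] at h2
  simp only [h1, h2]

/-- The sum runs over cofaces of `σ`, which may leave the image of `e` unless it contains the
neighbours of the vertices of `σ`. The other product below runs over faces and needs no such
condition. -/
theorem transpose_mul_incidence_simplexMap [Finite W] [Finite V] (h : L.IsFullEmbedding Q e)
    {k : ℕ} (σ ρ : L.Simplex k) (hσ : ∀ x ∈ σ.1, Q.closedNbhd (e x) ⊆ range e) :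
    ((Q.incidence k).transpose * Q.incidence k) (h.simplexMap σ) (h.simplexMap ρ) =
      ((L.incidence k).transpose * L.incidence k) σ ρ := by
  simp only [Matrix.mul_apply, Matrix.transpose_apply]
  symm
  refine Fintype.sum_of_injective h.simplexMap h.simplexMap_injective _ _ (fun τ hτ => ?_)
    fun τ => by simp only [incidence_simplexMap]
  by_contra hne
  refine hτ (h.mem_range_simplexMap τ ?_)
  obtain ⟨x, hx⟩ := (L.isRelLowerSet_faces σ.2.1).1
  exact (Q.subset_closedNbhd τ (Q.subset_of_incidence_ne_zero (left_ne_zero_of_mul hne)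
    ((h.mem_simplexMap σ x).2 hx))).trans (hσ x hx)

theorem incidence_mul_transpose_simplexMap [Finite W] [Finite V] (h : L.IsFullEmbedding Q e)
    {k : ℕ} (σ ρ : L.Simplex (k + 1)) :
    (Q.incidence k * (Q.incidence k).transpose) (h.simplexMap σ) (h.simplexMap ρ) =
      (L.incidence k * (L.incidence k).transpose) σ ρ := by
  simp only [Matrix.mul_apply, Matrix.transpose_apply]
  symm
  refine Fintype.sum_of_injective h.simplexMap h.simplexMap_injective _ _ (fun τ hτ => ?_)
    fun τ => by simp only [incidence_simplexMap]
  by_contra hne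
  refine hτ (h.mem_range_simplexMap τ ?_)
  refine (Finset.coe_subset.2 (Q.subset_of_incidence_ne_zero (left_ne_zero_of_mul hne))).trans ?_
  rw [coe_simplexMap]
  exact image_subset_range _ _

theorem lapMatrix_simplexMap [Finite W] [Finite V] (h : L.IsFullEmbedding Q e)
    {i : ℕ} (σ ρ : L.Simplex i) (hσ : ∀ x ∈ σ.1, Q.closedNbhd (e x) ⊆ range e) :
    Q.lapMatrix i (h.simplexMap σ) (h.simplexMap ρ) = L.lapMatrix i σ ρ := by
  cases i with
  | zero => exact h.transpose_mul_incidence_simplexMap σ ρ hσ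
  | succ i =>
    simp only [lapMatrix, Matrix.add_apply, h.incidence_mul_transpose_simplexMap,
      h.transpose_mul_incidence_simplexMap σ ρ hσ]

end IsFullEmbedding

/-! ### Locality of the powers of the Laplacian -/

section Locality

variable {V : Type*} (Q : OrientedComplex V)

/-- A nonzero entry forces `σ` and `ρ` to share a coface or a face, so one application of the
Laplacian moves by at most one edge. -/
theorem subset_closedNbhd_of_lapMatrix_ne_zero [Finite V] {i : ℕ} {σ ρ : Q.Simplex i}
    (h : Q.lapMatrix i σ ρ ≠ 0) : ∃ v ∈ σ.1, (ρ.1 : Set V) ⊆ Q.closedNbhd v := by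
  have h1 : ∀ {k} {σ ρ : Q.Simplex k}, ((Q.incidence k).transpose * Q.incidence k) σ ρ ≠ 0 →
      ∃ v ∈ σ.1, (ρ.1 : Set V) ⊆ Q.closedNbhd v := by
    intro k σ ρ h
    obtain ⟨τ, -, hτ⟩ := Finset.exists_ne_zero_of_sum_ne_zero h
    obtain ⟨v, hv⟩ := (Q.isRelLowerSet_faces σ.2.1).1
    exact ⟨v, hv, (Finset.coe_subset.2
      (Q.subset_of_incidence_ne_zero (right_ne_zero_of_mul hτ))).trans
      (Q.subset_closedNbhd τ (Q.subset_of_incidence_ne_zero (left_ne_zero_of_mul hτ) hv))⟩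
  have h2 : ∀ {k} {σ ρ : Q.Simplex (k + 1)},
      (Q.incidence k * (Q.incidence k).transpose) σ ρ ≠ 0 →
      ∃ v ∈ σ.1, (ρ.1 : Set V) ⊆ Q.closedNbhd v := by
    intro k σ ρ h
    obtain ⟨τ, -, hτ⟩ := Finset.exists_ne_zero_of_sum_ne_zero h
    obtain ⟨v, hv⟩ := (Q.isRelLowerSet_faces τ.2.1).1
    exact ⟨v, Q.subset_of_incidence_ne_zero (left_ne_zero_of_mul hτ) hv,
      Q.subset_closedNbhd ρ (Q.subset_of_incidence_ne_zero (right_ne_zero_of_mul hτ) hv)⟩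
  cases i with
  | zero => exact h1 h
  | succ i =>
    by_cases h3 : (Q.incidence i * (Q.incidence i).transpose) σ ρ = 0
    · refine h1 fun h4 => h ?_
      simp only [lapMatrix, Matrix.add_apply, h3, h4, add_zero]
    · exact h2 h3

theorem ballVertices_mono {r s : ℕ} (hrs : r ≤ s) (p : V) :
    Q.ballVertices r p ⊆ Q.ballVertices s p := fun v hv =>
  le_trans (b := (r : ℕ∞)) hv (by exact_mod_cast hrs)

theorem closedNbhd_subset_ballVertices {s : ℕ} {p v : V} (hv : v ∈ Q.ballVertices s p) :
    Q.closedNbhd v ⊆ Q.ballVertices (s + 1) p := by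
  rintro w (rfl | hw)
  · exact Q.ballVertices_mono s.le_succ p hv
  · change Q.skeleton.edist p w ≤ _
    have h1 : Q.skeleton.edist v w ≤ 1 := (SimpleGraph.edist_eq_one_iff_adj.2 hw).le
    exact (SimpleGraph.edist_triangle).trans ((add_le_add hv h1).trans (by simp))

theorem exists_mem_closedNbhd_of_mem_ballVertices {s : ℕ} {p v : V}
    (hv : v ∈ Q.ballVertices (s + 1) p) : ∃ u ∈ Q.ballVertices s p, v ∈ Q.closedNbhd u := by
  have hv' : Q.skeleton.edist p v ≤ ((s + 1 : ℕ) : ℕ∞) := hv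
  -- Reversing the walk makes its first step the one next to `v`.
  rw [SimpleGraph.edist_comm] at hv'
  obtain ⟨q, hq⟩ := SimpleGraph.exists_walk_of_edist_ne_top
    (ne_top_of_le_ne_top (ENat.natCast_ne_top (s + 1)) hv')
  rw [← hq] at hv'
  cases q with
  | nil => exact ⟨_, Q.mem_ballVertices s _, Or.inl rfl⟩
  | @cons _ u _ hadj q =>
    refine ⟨u, ?_, Or.inr hadj.symm⟩
    change Q.skeleton.edist p u ≤ _
    rw [SimpleGraph.edist_comm]
    refine (SimpleGraph.edist_le q).trans ?_
    rw [SimpleGraph.Walk.length_cons] at hv'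
    have : q.length + 1 ≤ s + 1 := by exact_mod_cast hv'
    exact_mod_cast Nat.le_of_succ_le_succ this

theorem ballVertices_zero (p : V) : Q.ballVertices 0 p = {p} := by
  ext v
  simp only [ballVertices, Nat.cast_zero, nonpos_iff_eq_zero, mem_ofPred_eq,
    SimpleGraph.edist_eq_zero_iff, mem_singleton_iff]
  exact eq_comm

theorem ncard_ballVertices_le [Finite V] {d : ℕ} (hd : Q.DegreeAtMost d) (r : ℕ) (p : V) :
    (Q.ballVertices r p).ncard ≤ (d + 1) ^ r := by
  classical
  induction r with
  | zero => simp [ballVertices_zero]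
  | succ r ih =>
    have hfin := Set.toFinite (Q.ballVertices r p)
    have h1 : Q.ballVertices (r + 1) p ⊆ ⋃ u ∈ hfin.toFinset, Q.closedNbhd u := by
      intro v hv
      obtain ⟨u, hu, huv⟩ := Q.exists_mem_closedNbhd_of_mem_ballVertices hv
      exact mem_biUnion (by simpa using hu) huv
    refine (ncard_le_ncard h1).trans ((Finset.set_ncard_biUnion_le _ _).trans ?_)
    refine (Finset.sum_le_card_nsmul _ _ (d + 1) fun u _ => Q.ncard_closedNbhd_le hd u).trans ?_
    rw [smul_eq_mul, pow_succ, ← ncard_eq_toFinset_card _ hfin]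
    exact Nat.mul_le_mul_right _ ih

/-- The sum of the diagonal entries of the `k`-th power of the Laplacian over the simplices that
contain `p`. -/
noncomputable def localTrace [Finite V] (i k : ℕ) (p : V) : ℝ :=
  open Classical in ∑ σ : Q.Simplex i, if p ∈ σ.1 then (Q.lapMatrix i ^ k) σ σ else 0

/-- Each `i`-simplex is counted once at each of its `i + 1` vertices. -/
theorem sum_localTrace [Fintype V] (i k : ℕ) :
    ∑ p, Q.localTrace i k p = (i + 1) * (Q.lapMatrix i ^ k).trace := by
  classical
  simp only [localTrace]
  rw [Finset.sum_comm, Matrix.trace, Finset.mul_sum]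
  refine Finset.sum_congr rfl fun σ _ => ?_
  rw [← Finset.sum_filter, Finset.sum_const, Finset.filter_univ_mem, σ.2.2, nsmul_eq_mul]
  push_cast
  rfl

end Locality

namespace IsFullEmbedding

variable {W V : Type*} [Finite V] {L : OrientedComplex W} {Q : OrientedComplex V} {e : W ↪ V}

/-- Each matrix factor costs one unit of radius: in the induction `k` drops by one while `s` grows
by one, so `s + k ≤ r` persists and all intermediate simplices stay in the image of `e`. -/
theorem lapMatrix_pow_simplexMap [Finite W] (h : L.IsFullEmbedding Q e) {r : ℕ} {p : V}
    (hr : Q.ballVertices r p ⊆ range e) {i : ℕ} (k : ℕ) :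
    ∀ s, s + k ≤ r → ∀ σ ρ : L.Simplex i,
      ((h.simplexMap σ).1 : Set V) ⊆ Q.ballVertices s p →
      (Q.lapMatrix i ^ k) (h.simplexMap σ) (h.simplexMap ρ) = (L.lapMatrix i ^ k) σ ρ := by
  induction k with
  | zero =>
    intro s _ σ ρ _
    simp only [pow_zero, Matrix.one_apply, h.simplexMap_injective.eq_iff]
  | succ k ih =>
    intro s hs σ ρ hσ
    have hnb : ∀ v ∈ (h.simplexMap σ).1, Q.closedNbhd v ⊆ Q.ballVertices (s + 1) p := fun v hv =>
      Q.closedNbhd_subset_ballVertices (hσ hv)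
    have hsr : Q.ballVertices (s + 1) p ⊆ range e :=
      (Q.ballVertices_mono (by omega) p).trans hr
    have hloc : ∀ τ, Q.lapMatrix i (h.simplexMap σ) τ ≠ 0 →
        (τ.1 : Set V) ⊆ Q.ballVertices (s + 1) p := fun τ hτ => by
      obtain ⟨v, hv, hv'⟩ := Q.subset_closedNbhd_of_lapMatrix_ne_zero hτ
      exact hv'.trans (hnb v hv)
    rw [pow_succ', pow_succ', Matrix.mul_apply, Matrix.mul_apply]
    symm
    refine Fintype.sum_of_injective h.simplexMap h.simplexMap_injective _ _ (fun τ hτ => ?_)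
      fun τ => ?_
    · by_contra hne
      exact hτ (h.mem_range_simplexMap τ ((hloc τ (left_ne_zero_of_mul hne)).trans hsr))
    · have h1 := h.lapMatrix_simplexMap σ τ fun x hx =>
        (hnb (e x) ((h.mem_simplexMap σ x).2 hx)).trans hsr
      rw [h1]
      by_cases h0 : L.lapMatrix i σ τ = 0
      · rw [h0, zero_mul, zero_mul]
      · rw [ih (s + 1) (by omega) τ ρ (hloc _ (by rwa [h1]))]

/-- In the radius `k + 1`, one unit contains the simplices at `e x` and the other `k` pay for the
power. -/
theorem localTrace_eq [Finite W] (h : L.IsFullEmbedding Q e) (i k : ℕ) (x : W)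
    (hr : Q.ballVertices (k + 1) (e x) ⊆ range e) :
    Q.localTrace i k (e x) = L.localTrace i k x := by
  classical
  have hball : ∀ σ : Q.Simplex i, e x ∈ σ.1 → (σ.1 : Set V) ⊆ Q.ballVertices 1 (e x) :=
    fun σ hσ => (Q.subset_closedNbhd σ hσ).trans
      (Q.closedNbhd_subset_ballVertices (Q.mem_ballVertices 0 _))
  unfold localTrace
  symm
  refine Fintype.sum_of_injective h.simplexMap h.simplexMap_injective _ _ (fun σ hσ => ?_)
    fun σ => ?_
  · refine if_neg fun hx => hσ (h.mem_range_simplexMap σ ((hball σ hx).trans ?_))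
    exact (Q.ballVertices_mono (by omega) _).trans hr
  · by_cases hx : x ∈ σ.1
    · rw [if_pos hx, if_pos ((h.mem_simplexMap σ x).2 hx),
        h.lapMatrix_pow_simplexMap hr k 1 (by omega) σ σ (hball _ ((h.mem_simplexMap σ x).2 hx))]
    · rw [if_neg hx, if_neg fun hx' => hx ((h.mem_simplexMap σ x).1 hx')]

theorem degreeAtMost (h : L.IsFullEmbedding Q e) {d : ℕ} (hd : Q.DegreeAtMost d) :
    L.DegreeAtMost d := fun x => by
  refine le_trans ?_ (hd (e x))
  refine Nat.card_le_card_of_injective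
    (fun τ : {τ : L.Simplex 1 // x ∈ τ.1} =>
      (⟨h.simplexMap τ.1, (h.mem_simplexMap τ.1 x).2 τ.2⟩ : {τ : Q.Simplex 1 // e x ∈ τ.1}))
    fun τ τ' hτ => ?_
  exact Subtype.ext (h.simplexMap_injective (congrArg Subtype.val hτ))

/-- A shortest path from the root stays inside the ball, so distances to the root measured within
the ball are still at most `r`. -/
theorem isRootedBall (h : L.IsFullEmbedding Q e) {d : ℕ} (hd : Q.DegreeAtMost d) {r : ℕ} {x : W}
    (hr : range e = Q.ballVertices r (e x)) : IsRootedBall d r L x := by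
  refine ⟨h.degreeAtMost hd, ?_⟩
  have key : ∀ s ≤ r, ∀ y, e y ∈ Q.ballVertices s (e x) → y ∈ L.ballVertices s x := by
    intro s
    induction s with
    | zero =>
      intro _ y hy
      rw [ballVertices_zero, mem_singleton_iff, e.injective.eq_iff] at hy
      subst hy
      exact L.mem_ballVertices 0 y
    | succ s ih =>
      intro hs y hy
      obtain ⟨u, hu, huy⟩ := Q.exists_mem_closedNbhd_of_mem_ballVertices hy
      obtain ⟨z, rfl⟩ : u ∈ range e := hr ▸ Q.ballVertices_mono (by omega) _ hu
      refine L.closedNbhd_subset_ballVertices (ih (by omega) z hu) ?_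
      rcases huy with huy | huy
      · exact Or.inl (e.injective huy)
      · exact Or.inr (h.adj_of_adj huy)
  intro y
  exact key r le_rfl y (hr ▸ mem_range_self y)

end IsFullEmbedding

/-! ### Isomorphism of rooted complexes -/

theorem RootedIso.symm {V W : Type*} {Q : OrientedComplex V} {x : V} {L : OrientedComplex W}
    {y : W} (h : RootedIso Q x L y) : RootedIso L y Q x := by
  obtain ⟨e, he, hf, hp⟩ := h
  refine ⟨e.symm, by rw [← he, e.symm_apply_apply], fun σ => ?_, fun k a => ?_⟩
  · rw [← hf, Finset.map_map]
    convert Iff.rfl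
    convert Finset.map_refl.symm
    ext w
    simp
  · rw [← hp, ← Function.comp_assoc, e.self_comp_symm, Function.id_comp]

theorem RootedIso.trans {U V W : Type*} {P : OrientedComplex U} {x : U} {Q : OrientedComplex V}
    {y : V} {L : OrientedComplex W} {z : W} (h : RootedIso P x Q y) (h' : RootedIso Q y L z) :
    RootedIso P x L z := by
  obtain ⟨e, he, hf, hp⟩ := h
  obtain ⟨e', he', hf', hp'⟩ := h'
  refine ⟨e.trans e', by simp [he, he'], fun σ => ?_, fun k a => ?_⟩
  · rw [← hf, ← hf', Finset.map_map]
    rfl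
  · rw [← hp, ← hp']
    rfl

theorem RootedIso.refl {V : Type*} (Q : OrientedComplex V) (x : V) : RootedIso Q x Q x :=
  ⟨Equiv.refl V, rfl, fun σ => by simp, fun _ _ => Iff.rfl⟩

theorem RootedIso.exists_isFullEmbedding {V W : Type*} {Q : OrientedComplex V} {r : ℕ} {p : V}
    {L : OrientedComplex W} {x : W}
    (h : RootedIso (Q.ball r p) ⟨p, Q.mem_ballVertices r p⟩ L x) :
    ∃ e : W ↪ V, L.IsFullEmbedding Q e ∧ e x = p ∧ range e = Q.ballVertices r p := by
  obtain ⟨e, he, hf, hp⟩ := h.symm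
  refine ⟨e.toEmbedding.trans (Function.Embedding.subtype _), ⟨fun σ => ?_, fun k a => ?_⟩,
    by simp [he], ?_⟩
  · rw [← hf, ← Finset.map_map]
    rfl
  · rw [← hp]
    rfl
  · rw [Function.Embedding.coe_trans, range_comp]
    simp

/-- Transport of an oriented complex along a bijection of the vertices. -/
def comapEquiv {V W : Type*} (Q : OrientedComplex V) (e : W ≃ V) : OrientedComplex W where
  faces := {σ | σ.map e.toEmbedding ∈ Q.faces}
  isRelLowerSet_faces := fun {σ} hσ =>
    ⟨by simpa using (Q.isRelLowerSet_faces hσ).1, fun τ hτσ hτ =>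
      (Q.isRelLowerSet_faces hσ).2 (Finset.map_subset_map.2 hτσ) (by simpa using hτ)⟩
  singleton_mem := fun v => by simpa using Q.singleton_mem (e v)
  IsPos := fun k a => Q.IsPos k (e ∘ a)
  isPos_injective := fun k a h => (Q.isPos_injective k _ h).of_comp
  isPos_range := fun k a h => by
    obtain ⟨σ, hσ, hr⟩ := Q.isPos_range k _ h
    refine ⟨σ.map e.symm.toEmbedding, ?_, ?_⟩
    · change Finset.map _ _ ∈ Q.faces
      rw [Finset.map_map]
      convert hσ
      convert Finset.map_refl
      ext w
      simp
    · rw [Finset.coe_map, hr, ← range_comp]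
      congr 1
      ext j
      simp
  exists_isPos := fun k σ hσ hc => by
    obtain ⟨a, ha, hr⟩ := Q.exists_isPos k _ hσ (by simpa using hc)
    refine ⟨e.symm ∘ a, ?_, ?_⟩
    · rwa [← Function.comp_assoc, e.self_comp_symm, Function.id_comp]
    · rw [range_comp, ← hr, Finset.coe_map, ← image_comp]
      simp
  isPos_perm := fun k a h π => Q.isPos_perm k _ h π

theorem rootedIso_comapEquiv {V W : Type*} (Q : OrientedComplex V) (e : W ≃ V) (x : V) :
    RootedIso Q x (Q.comapEquiv e) (e.symm x) :=
  RootedIso.symm ⟨e, e.apply_symm_apply x, fun _ => Iff.rfl, fun _ _ => Iff.rfl⟩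

/-- Positive orderings are injective, so only the finitely many `k < Nat.card W` carry information.
-/
instance {W : Type*} [Finite W] : Finite (OrientedComplex W) := by
  classical
  refine Finite.of_injective (β := Set (Finset W) ×
    (∀ k : Fin (Nat.card W), (Fin (k + 1) → W) → Prop))
    (fun Q => (Q.faces, fun k => Q.IsPos k)) fun Q L h => ?_
  have h1 : Q.faces = L.faces := congrArg Prod.fst h
  have h2 : Q.IsPos = L.IsPos := by
    funext k a
    by_cases hk : k < Nat.card W
    · exact congrFun (congrFun (congrArg Prod.snd h) ⟨k, hk⟩) a
    · have h3 : ¬ Function.Injective a := fun ha => by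
        have := Nat.card_le_card_of_injective a ha
        rw [Nat.card_eq_fintype_card, Fintype.card_fin] at this
        omega
      exact propext ⟨fun h' => (h3 (Q.isPos_injective k a h')).elim,
        fun h' => (h3 (L.isPos_injective k a h')).elim⟩
  obtain ⟨⟨⟨F, _⟩, _⟩, P, _, _, _, _⟩ := Q
  obtain ⟨⟨⟨F', _⟩, _⟩, P', _, _, _, _⟩ := L
  obtain rfl : F = F' := h1
  obtain rfl : P = P' := h2
  rfl

/-- There are finitely many isomorphism classes of rooted balls of given radius and degree bound. -/
theorem exists_finite_ball_types.{u} (d r : ℕ) :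
    ∃ (κ : Type) (_ : Fintype κ) (m : κ → ℕ) (L : ∀ q, OrientedComplex (Fin (m q)))
      (x : ∀ q, Fin (m q)), (∀ q, IsRootedBall d r (L q) (x q)) ∧
      ∀ (V : Type u) [Finite V] (Q : OrientedComplex V), Q.DegreeAtMost d → ∀ p : V,
        ∃! q, RootedIso (Q.ball r p) ⟨p, Q.mem_ballVertices r p⟩ (L q) (x q) := by
  classical
  -- A ball of radius `r` has at most `(d + 1) ^ r` vertices, so it has a model on `Fin m` with `m`
  -- in this range. Passing to the quotient by isomorphism makes the type of a vertex unique.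
  let T := {t : Σ m : Fin ((d + 1) ^ r + 1), OrientedComplex (Fin m) × Fin m //
    IsRootedBall d r t.2.1 t.2.2}
  let S : Setoid T :=
    { r := fun t t' => RootedIso t.1.2.1 t.1.2.2 t'.1.2.1 t'.1.2.2
      iseqv := ⟨fun t => RootedIso.refl _ _, fun h => h.symm, fun h h' => h.trans h'⟩ }
  refine ⟨Quotient S, Fintype.ofFinite _, fun q => q.out.1.1, fun q => q.out.1.2.1,
    fun q => q.out.1.2.2, fun q => q.out.2, fun V _ Q hd p => ?_⟩
  let e : Fin (Nat.card (Q.ballVertices r p)) ≃ Q.ballVertices r p := (Finite.equivFin _).symm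
  have hm : Nat.card (Q.ballVertices r p) < (d + 1) ^ r + 1 := by
    rw [Nat.card_coe_set_eq]
    exact Nat.lt_succ_of_le (Q.ncard_ballVertices_le hd r p)
  have hiso := (Q.ball r p).rootedIso_comapEquiv e ⟨p, Q.mem_ballVertices r p⟩
  obtain ⟨f, hf, hfp, hr⟩ := hiso.exists_isFullEmbedding
  let t : T := ⟨⟨⟨_, hm⟩, (Q.ball r p).comapEquiv e, _⟩, hf.isRootedBall hd (by rw [hfp, hr])⟩
  refine ⟨Quotient.mk S t, hiso.trans (Quotient.exact (Quotient.out_eq (Quotient.mk S t))).symm,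
    fun q hq => ?_⟩
  rw [← Quotient.out_eq q]
  exact Quotient.sound (hq.symm.trans hiso)

/-! ### Convergence of the normalized traces -/

/-- The local trace depends only on the ball type, so the vertices can be grouped by type. -/
theorem sum_localTrace_eq {V : Type*} [Fintype V] (Q : OrientedComplex V) (i k : ℕ)
    {κ : Type*} [Fintype κ] {m : κ → ℕ} (L : ∀ q, OrientedComplex (Fin (m q)))
    (x : ∀ q, Fin (m q))
    (h : ∀ p : V, ∃! q, RootedIso (Q.ball (k + 1) p) ⟨p, Q.mem_ballVertices (k + 1) p⟩ (L q) (x q)) :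
    (∑ p, Q.localTrace i k p) / Nat.card V =
      ∑ q, (L q).localTrace i k (x q) * Q.ballFrequency (k + 1) (L q) (x q) := by
  classical
  have h1 : ∀ p, Q.localTrace i k p = ∑ q,
      if RootedIso (Q.ball (k + 1) p) ⟨p, Q.mem_ballVertices (k + 1) p⟩ (L q) (x q) then
        (L q).localTrace i k (x q) else 0 := fun p => by
    obtain ⟨q, hq, huniq⟩ := h p
    rw [Finset.sum_eq_single q (fun q' _ hne => if_neg fun hq' => hne (huniq q' hq')) (by simp),
      if_pos hq]
    obtain ⟨e, he, hx, hr⟩ := hq.exists_isFullEmbedding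
    subst hx
    exact he.localTrace_eq i k (x q) hr.ge
  simp only [h1, ballFrequency]
  rw [Finset.sum_comm, Finset.sum_div]
  refine Finset.sum_congr rfl fun q _ => ?_
  rw [← Finset.sum_filter, Finset.sum_const, nsmul_eq_mul,
    Nat.card_eq_fintype_card (α := {p // _}), Fintype.card_subtype]
  ring

theorem Convergent.exists_tendsto_trace {V : ℕ → Type*} [∀ n, Finite (V n)] {d : ℕ}
    {Q : ∀ n, OrientedComplex (V n)} (hconv : Convergent d Q) (hd : ∀ n, (Q n).DegreeAtMost d)
    (i k : ℕ) :
    ∃ l, Tendsto (fun n => ((Q n).lapMatrix i ^ k).trace / Nat.card (V n)) atTop (𝓝 l) := by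
  obtain ⟨κ, _, m, L, x, hL, hex⟩ := exists_finite_ball_types d (k + 1)
  choose l hl using fun q => hconv.2 (k + 1) (by omega) (m q) (L q) (x q) (hL q)
  refine ⟨((i : ℝ) + 1)⁻¹ * ∑ q, (L q).localTrace i k (x q) * l q, ?_⟩
  refine ((tendsto_finsetSum _ fun q _ => (hl q).const_mul _).const_mul _).congr fun n => ?_
  have := Fintype.ofFinite (V n)
  rw [← (Q n).sum_localTrace_eq i k L x (hex _ (Q n) (hd n)), sum_localTrace]
  field_simp

end OrientedComplex

/-! ### Assembly of the proposition. -/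

open OrientedComplex in
theorem mainTheorem3 (d : ℕ) (V : ℕ → Type*) [∀ n, Finite (V n)]
    (Q : ∀ n, OrientedComplex (V n)) (hdeg : ∀ n, (Q n).DegreeAtMost d)
    (hconv : OrientedComplex.Convergent d Q) :
    ∃ K : ℝ, 0 < K ∧
      (∀ i n, ‖(Q n).laplacian i‖ ≤ K) ∧
      (∀ i n, spectralMeasure ((Q n).laplacian i) (Icc 0 K)ᶜ = 0) ∧
      (∀ i, ¬ Tendsto (fun n => (Q n).simplexDensity i) atTop (𝓝 0) →
        ∃ μ : Measure ℝ, IsProbabilityMeasure μ ∧ μ (Icc 0 K)ᶜ = 0 ∧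
          WeaklyConvergesOn K (fun n => spectralMeasure ((Q n).laplacian i)) μ) ∧
      (∀ i n,
        IntegrableOn Real.log (Ioc 0 K) (spectralMeasure ((Q n).laplacian i)) ∧
        Tendsto (fun ε : ℝ => ∫ t in Icc ε K, Real.log t ∂(spectralMeasure ((Q n).laplacian i)))
          (𝓝[>] 0) (𝓝 (logIntegral K (spectralMeasure ((Q n).laplacian i)))) ∧
        0 ≤ logIntegral K (spectralMeasure ((Q n).laplacian i))) := by
  have hsymm : ∀ i n, ((Q n).laplacian i : (Q n).Cochain i →ₗ[ℝ] (Q n).Cochain i).IsSymmetric :=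
    fun i n => ((Q n).isPositive_laplacian i).isSymmetric
  have hpos : ∀ i n x, 0 ≤ inner ℝ x ((Q n).laplacian i x) :=
    fun i n x => ((Q n).isPositive_laplacian i).inner_nonneg_right x
  have hK : ∀ i n, ‖(Q n).laplacian i‖ ≤ 2 * (2 ^ (d + 1) * (d + 1)) ^ 2 :=
    fun i n => (Q n).norm_laplacian_le (hdeg n) i
  refine ⟨2 * (2 ^ (d + 1) * (d + 1)) ^ 2, by positivity, hK,
    fun i n => spectralMeasure_compl_Icc (hsymm i n) (hpos i n) (hK i n), fun i hi => ?_,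
    fun i n => ⟨?_, ?_, ?_⟩⟩
  · have hrank : ∀ n, Module.finrank ℝ ((Q n).Cochain i) = Nat.card ((Q n).Simplex i) := fun n => by
      rw [finrank_euclideanSpace, Nat.card_eq_fintype_card]
    choose l hl using hconv.exists_tendsto_trace hdeg i
    -- The trace of the zeroth power counts the simplices, so the density always has a limit; not
    -- tending to `0` thus means a nonzero limit.
    have hdens : Tendsto (fun n => (Q n).simplexDensity i) atTop (𝓝 (l 0)) := by
      refine (hl 0).congr fun n => ?_
      rw [pow_zero, Matrix.trace_one, simplexDensity,
        Nat.card_eq_fintype_card (α := (Q n).Simplex i)]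
    have hl0 : l 0 ≠ 0 := fun h => hi (h ▸ hdens)
    have hne : ∀ᶠ n in atTop, (Q n).simplexDensity i ≠ 0 := hdens.eventually_ne hl0
    refine exists_weaklyConvergesOn ?_
      (fun n => spectralMeasure_compl_Icc (hsymm i n) (hpos i n) (hK i n))
      fun k => ⟨l k / l 0, ?_⟩
    · filter_upwards [hne] with n hn
      refine isProbabilityMeasure_spectralMeasure (hsymm i n) ?_
      rw [hrank, Nat.pos_iff_ne_zero]
      intro h
      rw [simplexDensity, h, Nat.cast_zero, zero_div] at hn
      exact hn rfl
    -- Moment = (trace per vertex) / (simplices per vertex). A nonzero density also ensures that the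
    -- cancelled number of vertices is nonzero.
    · refine ((hl k).div hdens hl0).congr' ?_
      filter_upwards [hne] with n hn
      rw [setIntegral_pow_spectralMeasure (hsymm i n) (hpos i n) (hK i n), hrank,
        trace_laplacian_pow]
      exact div_div_div_cancel_right₀ (fun h => hn (by rw [simplexDensity, h, div_zero])) _ _
  · rw [spectralMeasure_eq_sum (hsymm i n) rfl]
    exact (integrable_sum_dirac _ _ _).integrableOn
  · rw [spectralMeasure_eq_sum (hsymm i n) rfl]
    exact tendsto_setIntegral_log_sum_dirac _ _ (by positivity) _
  · obtain ⟨p, hp⟩ := (Q n).exists_int_charpoly_laplacian i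
    exact logIntegral_spectralMeasure_nonneg (hsymm i n) (hpos i n) (hK i n) p hp
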